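/- For every $n$ let $d=d(n)$ and $p=p(n)$ be positive integers with $d<n^{1/2}$ for all sufficiently large $n$, put $N=N(n)=\binom{n}{d}$, and suppose $N/p\to\gamma\in(0,\infty)$ as $n\to\infty$. Let $x(n)$ be a real random variable and $C=C(n)\ge 2$ a real number such that $x(n)\overset{d}{=}-x(n)$, $\mathbb{E}[x(n)^2]=1$, $\mathbb{E}[x(n)^{2k}]\le (Ck)^k$ for all $k\in\mathbb{N}$, and $$\lim_{n\to\infty}\frac{\log C(n)}{\log\big(n^{1/2}/d(n)\big)}=0 .$$ Let $Z_0=(x_{i_1}x_{i_2}\cdots x_{i_d})_{1\le i_1<\cdots<i_d\le n}\in\mathbb{R}^{N}$, where $x_1,\dots,x_n$ are i.i.d. copies of $x(n)$, and let $Z=Z(n)\in\mathbb{R}^{N\times p}$ be random matrices, all defined on one probability space (with arbitrary joint distribution over different $n$), such that for each $n$ the $p$ columns of $Z(n)$ are i.i.d. with the law of $Z_0$. Let $S=\frac1p ZZ^T$ with eigenvalues $\lambda_1(S),\dots,\lambda_N(S)$, counted with multiplicity, and let $F_S(x)=\frac1N\#\{j:\lambda_j(S)\le x\}$ be its empirical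 spectral distribution. Then, almost surely, $F_{S(n)}$ converges weakly as $n\to\infty$ (that is, $F_{S(n)}(x)\to F_\gamma(x)$ at every continuity point $x$ of $F_\gamma$) to the Marchenko–Pastur law $$F_\gamma(x)=\Big(1-\frac1\gamma\Big)\chi_{x\ge 0,\ \gamma>1}+\int_{-\infty}^x p_\gamma(y)\,dy,$$ where $$p_\gamma(y)=\frac{\sqrt{\big((1+\sqrt\gamma)^2-y\big)\big(y-(1-\sqrt\gamma)^2\big)}}{2\pi\gamma y}$$ for $y\in[(1-\sqrt\gamma)^2,(1+\sqrt\gamma)^2]$ and $p_\gamma(y)=0$ otherwise. -/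

import Mathlib

open MeasureTheory ProbabilityTheory Filter Topology

noncomputable section

namespace RandomTensor

/-- The strictly increasing tuples `i₁ < ⋯ < i_d` of indices in `{1, …, n}`, encoded as the
`d`-element subsets of `Fin n`. There are `n.choose d` of them. -/
abbrev TensorIndex (n d : ℕ) : Type := {s : Finset (Fin n) // s.card = d}

/-- The vector `(x_{i₁} ⋯ x_{i_d})_{i₁ < ⋯ < i_d}` built from `x = (x₁, …, x_n)`. -/
def tensorVector (n d : ℕ) (x : Fin n → ℝ) : TensorIndex n d → ℝ :=
  fun s => ∏ i ∈ s.1, x i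

/-- The law of the random vector `(x_{i₁} ⋯ x_{i_d})_{i₁ < ⋯ < i_d}` when `x₁, …, x_n` are
i.i.d. with law `μ`. -/
def tensorLaw (n d : ℕ) (μ : Measure ℝ) : Measure (TensorIndex n d → ℝ) :=
  (Measure.pi fun _ : Fin n => μ).map (tensorVector n d)

/-- The sample covariance matrix `p⁻¹ Z Zᵀ` of a matrix `Z` with `p` columns. -/
def sampleCov {ι : Type*} {p : ℕ} (Z : Matrix ι (Fin p) ℝ) : Matrix ι ι ℝ :=
  (1 / (p : ℝ)) • (Z * Z.transpose)

theorem sampleCov_isHermitian {ι : Type*} {p : ℕ} (Z : Matrix ι (Fin p) ℝ) :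
    (sampleCov Z).IsHermitian := by
  ext i j
  simp [sampleCov, Matrix.mul_apply, mul_comm]

/-- The empirical spectral distribution function of a real symmetric matrix `A`: the proportion
of eigenvalues of `A`, counted with multiplicity, that are at most `x`. -/
def esd {ι : Type*} [Fintype ι] [DecidableEq ι] {A : Matrix ι ι ℝ} (hA : A.IsHermitian)
    (x : ℝ) : ℝ :=
  (1 / (Fintype.card ι : ℝ)) * ∑ j : ι, (Set.Ici (hA.eigenvalues j)).indicator 1 x

/-- The density of the absolutely continuous part of the Marchenko–Pastur law. -/
def mpDensity (γ y : ℝ) : ℝ :=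
  (Set.Icc ((1 - √γ) ^ 2) ((1 + √γ) ^ 2)).indicator
    (fun y => √(((1 + √γ) ^ 2 - y) * (y - (1 - √γ) ^ 2)) / (2 * Real.pi * γ * y)) y

/-- The distribution function of the Marchenko–Pastur law with parameter `γ`. -/
def mpCDF (γ x : ℝ) : ℝ :=
  (if 0 ≤ x ∧ 1 < γ then 1 - 1 / γ else 0) + ∫ y in Set.Iic x, mpDensity γ y

/-- Weak convergence of distribution functions: convergence at every continuity point of the
limit. -/
def WeaklyConverges (F : ℕ → ℝ → ℝ) (G : ℝ → ℝ) : Prop :=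
  ∀ x : ℝ, ContinuousAt G x → Tendsto (fun n => F n x) atTop (𝓝 (G x))

end RandomTensor

end

/-!
The spectrum is studied through the resolvent trace `tr R(t)`, `R(t) = (t + S)⁻¹`, for `t > 0`.
By the Sherman–Morrison formula `N - t tr R = ∑ⱼ (1 - 1 / (1 + qⱼ))`, where `qⱼ = p⁻¹ zⱼᵀ R⁽ʲ⁾ zⱼ`
and `R⁽ʲ⁾` is the resolvent without the `j`-th column. Given the other columns, `qⱼ` concentrates
around `p⁻¹ tr R⁽ʲ⁾`: the covariances of the products `z_s z_t` of tensor entries are nonnegative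
and, by counting overlaps of the index sets, their row sums are at most `N (exp (2 m₄ d² / n) - 1)`
with `m₄` the fourth moment, so Schur's test bounds the variance of the quadratic form.
Bounded differences and Borel–Cantelli make `N⁻¹ tr R` concentrate around its mean almost surely.
Every limit point `m` of the means then solves `γ t m² + (t + 1 - γ) m - 1 = 0`, whose only
positive root is the Stieltjes transform of the Marchenko–Pastur law. Finally, the constants and the
functions `1 / (x + t)`, for `t` in a countable dense set, span a dense subspace of the continuous
functions of `1 / (1 + x) ∈ [0, 1]`, so convergence at these countably many `t` gives weak
convergence.
-/

noncomputable section

namespace RandomTensor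

section Resolvent

open Matrix

variable {ι : Type*} [Fintype ι] [DecidableEq ι] {A : Matrix ι ι ℝ} {t : ℝ}

/-- The inverse `(t + A)⁻¹`, i.e. minus the resolvent of `A` at `-t`. It is only used for positive
semidefinite `A` and `t > 0`, where `t + A` is invertible. -/
def shiftedInv (t : ℝ) (A : Matrix ι ι ℝ) : Matrix ι ι ℝ := (t • (1 : Matrix ι ι ℝ) + A)⁻¹

omit [Fintype ι] in
theorem posDef_smul_one_add (ht : 0 < t) (hA : A.PosSemidef) :
    (t • (1 : Matrix ι ι ℝ) + A).PosDef :=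
  (PosDef.one.smul ht).add_posSemidef hA

theorem posDef_shiftedInv (ht : 0 < t) (hA : A.PosSemidef) : (shiftedInv t A).PosDef :=
  (posDef_smul_one_add ht hA).inv

theorem isUnit_det_smul_one_add (ht : 0 < t) (hA : A.PosSemidef) :
    IsUnit (t • (1 : Matrix ι ι ℝ) + A).det :=
  (isUnit_iff_isUnit_det _).1 (posDef_smul_one_add ht hA).isUnit

theorem transpose_shiftedInv (ht : 0 < t) (hA : A.PosSemidef) :
    (shiftedInv t A)ᵀ = shiftedInv t A :=
  (conjTranspose_eq_transpose_of_trivial _).symm.trans (posDef_shiftedInv ht hA).isHermitian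

theorem shiftedInv_mul_self (ht : 0 < t) (hA : A.PosSemidef) :
    shiftedInv t A * A = 1 - t • shiftedInv t A := by
  have h : shiftedInv t A * (t • 1 + A) = 1 := nonsing_inv_mul _ (isUnit_det_smul_one_add ht hA)
  rw [mul_add, mul_smul_comm, mul_one] at h
  exact eq_sub_of_add_eq' h

theorem posSemidef_shiftedInv_sub_smul_mul_self (ht : 0 < t) (hA : A.PosSemidef) :
    (shiftedInv t A - t • (shiftedInv t A * shiftedInv t A)).PosSemidef := by
  have h := hA.mul_mul_conjTranspose_same (shiftedInv t A)
  rwa [(posDef_shiftedInv ht hA).isHermitian.eq, shiftedInv_mul_self ht hA, sub_mul, one_mul,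
    smul_mul_assoc] at h

theorem mul_dotProduct_shiftedInv_mulVec_le (ht : 0 < t) (hA : A.PosSemidef) (v : ι → ℝ) :
    t * (shiftedInv t A *ᵥ v ⬝ᵥ shiftedInv t A *ᵥ v) ≤ v ⬝ᵥ shiftedInv t A *ᵥ v := by
  have hsq : v ⬝ᵥ (shiftedInv t A * shiftedInv t A) *ᵥ v =
      shiftedInv t A *ᵥ v ⬝ᵥ shiftedInv t A *ᵥ v := by
    rw [← mulVec_mulVec, dotProduct_mulVec, ← mulVec_transpose, transpose_shiftedInv ht hA]
  have h := (posSemidef_shiftedInv_sub_smul_mul_self ht hA).dotProduct_mulVec_nonneg v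
  rwa [star_trivial, sub_mulVec, dotProduct_sub, smul_mulVec, dotProduct_smul, hsq, smul_eq_mul,
    sub_nonneg] at h

theorem mul_sum_sq_shiftedInv_le (ht : 0 < t) (hA : A.PosSemidef) (s : ι) :
    t * ∑ u, shiftedInv t A s u ^ 2 ≤ shiftedInv t A s s := by
  have hsymm (u : ι) : shiftedInv t A u s = shiftedInv t A s u :=
    congrFun₂ (transpose_shiftedInv ht hA) s u
  have h := (posSemidef_shiftedInv_sub_smul_mul_self ht hA).diag_nonneg (i := s)
  rw [Matrix.sub_apply, Matrix.smul_apply, mul_apply, smul_eq_mul, sub_nonneg] at h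
  simpa only [hsymm, ← sq] using h

theorem shiftedInv_apply_self_le (ht : 0 < t) (hA : A.PosSemidef) (s : ι) :
    shiftedInv t A s s ≤ 1 / t := by
  have hdiag : shiftedInv t A s s ^ 2 ≤ ∑ u, shiftedInv t A s u ^ 2 :=
    Finset.single_le_sum (f := fun u => shiftedInv t A s u ^ 2) (fun _ _ => sq_nonneg _)
      (Finset.mem_univ s)
  have hpos : 0 < shiftedInv t A s s := (posDef_shiftedInv ht hA).diag_pos
  rw [le_div_iff₀ ht]
  have := mul_sum_sq_shiftedInv_le ht hA s
  nlinarith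

theorem sum_sq_shiftedInv_le (ht : 0 < t) (hA : A.PosSemidef) (s : ι) :
    ∑ u, shiftedInv t A s u ^ 2 ≤ (1 / t) ^ 2 := by
  rw [sq (1 / t), ← div_eq_mul_one_div, le_div_iff₀' ht]
  exact (mul_sum_sq_shiftedInv_le ht hA s).trans (shiftedInv_apply_self_le ht hA s)

theorem trace_shiftedInv_le (ht : 0 < t) (hA : A.PosSemidef) :
    (shiftedInv t A).trace ≤ Fintype.card ι * (1 / t) := by
  rw [← nsmul_eq_mul]
  exact Finset.sum_le_card_nsmul _ _ _ fun s _ => shiftedInv_apply_self_le ht hA s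

theorem trace_shiftedInv_eq_sum_eigenvalues (hA : A.IsHermitian)
    (h : ∀ i, t + hA.eigenvalues i ≠ 0) :
    (shiftedInv t A).trace = ∑ i, 1 / (t + hA.eigenvalues i) := by
  set φ := Unitary.conjStarAlgAut ℝ (Matrix ι ι ℝ) hA.eigenvectorUnitary with hφ
  have hA_eq : A = φ (diagonal hA.eigenvalues) := hA.spectral_theorem
  have hshift : t • (1 : Matrix ι ι ℝ) + A = φ (diagonal fun i => t + hA.eigenvalues i) := by
    rw [← diagonal_add, ← smul_one_eq_diagonal, map_add, map_smul, map_one, ← hA_eq]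
  have hinv : shiftedInv t A = φ (diagonal fun i => 1 / (t + hA.eigenvalues i)) := by
    refine inv_eq_right_inv ?_
    rw [hshift, ← map_mul, diagonal_mul_diagonal]
    simp only [mul_one_div_cancel (h _), diagonal_one, map_one]
  rw [hinv, hφ, Unitary.conjStarAlgAut_apply, trace_mul_cycle, Unitary.coe_star_mul_self, one_mul,
    trace_diagonal]

theorem shiftedInv_sub_shiftedInv {B : Matrix ι ι ℝ} (ht : 0 < t) (hA : A.PosSemidef)
    (hB : B.PosSemidef) :
    shiftedInv t A - shiftedInv t B = shiftedInv t B * (B - A) * shiftedInv t A := by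
  rw [← neg_sub (shiftedInv t B), shiftedInv, shiftedInv, Matrix.inv_sub_inv
    (iff_of_true (posDef_smul_one_add ht hB).isUnit (posDef_smul_one_add ht hA).isUnit),
    add_sub_add_left_eq_sub, ← neg_sub B A, mul_neg, neg_mul, neg_neg]

section RankOne

variable {a : ℝ} (v : ι → ℝ)

omit [DecidableEq ι] in
theorem posSemidef_smul_vecMulVec (ha : 0 ≤ a) : (a • vecMulVec v v).PosSemidef := by
  simpa only [star_trivial] using (posSemidef_vecMulVec_self_star v).smul ha

theorem shiftedInv_sub_shiftedInv_add_smul_vecMulVec (ht : 0 < t) (hA : A.PosSemidef)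
    (ha : 0 ≤ a) :
    shiftedInv t A - shiftedInv t (A + a • vecMulVec v v) =
      a • vecMulVec (shiftedInv t (A + a • vecMulVec v v) *ᵥ v) (shiftedInv t A *ᵥ v) := by
  rw [shiftedInv_sub_shiftedInv ht hA (hA.add (posSemidef_smul_vecMulVec v ha)),
    add_sub_cancel_left, mul_smul_comm, smul_mul_assoc, mul_vecMulVec, vecMulVec_mul,
    ← mulVec_transpose, transpose_shiftedInv ht hA]

theorem one_add_mul_quadForm_pos (ht : 0 < t) (hA : A.PosSemidef) (ha : 0 ≤ a) :
    0 < 1 + a * (v ⬝ᵥ shiftedInv t A *ᵥ v) := by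
  have h := (posDef_shiftedInv ht hA).posSemidef.dotProduct_mulVec_nonneg v
  rw [star_trivial] at h
  positivity

/-- The Sherman–Morrison formula, applied to the perturbing vector. -/
theorem smul_shiftedInv_add_smul_vecMulVec_mulVec (ht : 0 < t) (hA : A.PosSemidef) (ha : 0 ≤ a) :
    (1 + a * (v ⬝ᵥ shiftedInv t A *ᵥ v)) • shiftedInv t (A + a • vecMulVec v v) *ᵥ v =
      shiftedInv t A *ᵥ v := by
  have h := congrArg (· *ᵥ v) (shiftedInv_sub_shiftedInv_add_smul_vecMulVec v ht hA ha)
  simp only [sub_mulVec, smul_mulVec, vecMulVec_mulVec, op_smul_eq_smul, smul_smul,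
    dotProduct_comm _ v] at h
  rw [add_smul, one_smul, ← h, add_sub_cancel]

theorem mul_quadForm_shiftedInv_add_smul_vecMulVec (ht : 0 < t) (hA : A.PosSemidef)
    (ha : 0 ≤ a) :
    a * (v ⬝ᵥ shiftedInv t (A + a • vecMulVec v v) *ᵥ v) =
      1 - 1 / (1 + a * (v ⬝ᵥ shiftedInv t A *ᵥ v)) := by
  have h := congrArg (v ⬝ᵥ ·) (smul_shiftedInv_add_smul_vecMulVec_mulVec v ht hA ha)
  simp only [dotProduct_smul, smul_eq_mul] at h
  have hpos := one_add_mul_quadForm_pos v ht hA ha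
  field_simp
  linear_combination a * h

theorem one_add_mul_quadForm_mul_trace_sub_trace (ht : 0 < t) (hA : A.PosSemidef) (ha : 0 ≤ a) :
    (1 + a * (v ⬝ᵥ shiftedInv t A *ᵥ v)) *
        ((shiftedInv t A).trace - (shiftedInv t (A + a • vecMulVec v v)).trace) =
      a * (shiftedInv t A *ᵥ v ⬝ᵥ shiftedInv t A *ᵥ v) := by
  rw [← trace_sub, shiftedInv_sub_shiftedInv_add_smul_vecMulVec v ht hA ha, trace_smul,
    trace_vecMulVec, smul_eq_mul, mul_left_comm, ← smul_eq_mul (1 + _), ← smul_dotProduct,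
    smul_shiftedInv_add_smul_vecMulVec_mulVec v ht hA ha]

theorem trace_shiftedInv_sub_trace_mem_Icc (ht : 0 < t) (hA : A.PosSemidef) (ha : 0 ≤ a) :
    (shiftedInv t A).trace - (shiftedInv t (A + a • vecMulVec v v)).trace ∈
      Set.Icc 0 (1 / t) := by
  have hpos := one_add_mul_quadForm_pos v ht hA ha
  have heq := one_add_mul_quadForm_mul_trace_sub_trace v ht hA ha
  have hnorm : 0 ≤ shiftedInv t A *ᵥ v ⬝ᵥ shiftedInv t A *ᵥ v :=
    Finset.sum_nonneg fun _ _ => mul_self_nonneg _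
  have hle := mul_le_mul_of_nonneg_left (mul_dotProduct_shiftedInv_mulVec_le ht hA v) ha
  refine ⟨nonneg_of_mul_nonneg_right (heq ▸ mul_nonneg ha hnorm) hpos, ?_⟩
  rw [le_div_iff₀ ht, ← mul_le_mul_iff_right₀ hpos]
  linear_combination hle + t * heq

end RankOne

section ColumnResolvent

variable {p : ℕ}

/-- The resolvent `(t + p⁻¹ ∑_{j ∈ J} zⱼ zⱼᵀ)⁻¹` of the sample covariance matrix that only retains
the columns in `J`; the normalisation by the total number `p` of columns does not depend on `J`. -/
def columnResolvent (t : ℝ) (J : Finset (Fin p)) (z : Fin p → ι → ℝ) : Matrix ι ι ℝ :=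
  shiftedInv t (∑ j ∈ J, (1 / (p : ℝ)) • vecMulVec (z j) (z j))

/-- The Stieltjes transform at `-t` of the spectral distribution of `p⁻¹ ∑ⱼ zⱼ zⱼᵀ`. -/
def resolventTrace (t : ℝ) (z : Fin p → ι → ℝ) : ℝ :=
  (columnResolvent t Finset.univ z).trace / Fintype.card ι

/-- The quadratic form `p⁻¹ zⱼᵀ R⁽ʲ⁾ zⱼ`, where `R⁽ʲ⁾` is the resolvent without the column `zⱼ`. -/
def leaveOneOutForm (t : ℝ) (j : Fin p) (z : Fin p → ι → ℝ) : ℝ :=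
  1 / (p : ℝ) * (z j ⬝ᵥ columnResolvent t (Finset.univ.erase j) z *ᵥ z j)

omit [DecidableEq ι] in
theorem posSemidef_sum_smul_vecMulVec (J : Finset (Fin p)) (z : Fin p → ι → ℝ) :
    (∑ j ∈ J, (1 / (p : ℝ)) • vecMulVec (z j) (z j)).PosSemidef :=
  posSemidef_sum _ fun j _ => posSemidef_smul_vecMulVec (z j) (by positivity)

omit [Fintype ι] [DecidableEq ι] in
theorem sum_smul_vecMulVec_eq_sampleCov (Z : Matrix ι (Fin p) ℝ) :
    ∑ j, (1 / (p : ℝ)) • vecMulVec (Z.col j) (Z.col j) = sampleCov Z := by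
  ext i k
  simp [sampleCov, Matrix.sum_apply, vecMulVec_apply, mul_apply, Finset.mul_sum]

theorem columnResolvent_univ (t : ℝ) (j : Fin p) (z : Fin p → ι → ℝ) :
    columnResolvent t Finset.univ z =
      shiftedInv t (∑ i ∈ Finset.univ.erase j, (1 / (p : ℝ)) • vecMulVec (z i) (z i) +
        (1 / (p : ℝ)) • vecMulVec (z j) (z j)) := by
  rw [columnResolvent, Finset.sum_erase_add _ _ (Finset.mem_univ j)]

theorem columnResolvent_erase_update (t : ℝ) (j : Fin p) (z : Fin p → ι → ℝ) (w : ι → ℝ) :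
    columnResolvent t (Finset.univ.erase j) (Function.update z j w) =
      columnResolvent t (Finset.univ.erase j) z := by
  refine congrArg (shiftedInv t) (Finset.sum_congr rfl fun i hi => ?_)
  rw [Function.update_of_ne (Finset.ne_of_mem_erase hi)]

theorem continuous_columnResolvent (ht : 0 < t) (J : Finset (Fin p)) :
    Continuous fun z : Fin p → ι → ℝ => columnResolvent t J z := by
  have hvec (j : Fin p) : Continuous fun z : Fin p → ι → ℝ => vecMulVec (z j) (z j) :=
    (continuous_apply j).matrix_vecMulVec (continuous_apply j)
  have hcov : Continuous fun z : Fin p → ι → ℝ =>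
      t • (1 : Matrix ι ι ℝ) + ∑ j ∈ J, (1 / (p : ℝ)) • vecMulVec (z j) (z j) :=
    continuous_const.add <| continuous_finsetSum _ fun j _ => (hvec j).const_smul (1 / (p : ℝ))
  simp only [columnResolvent, shiftedInv, Matrix.inv_def, Ring.inverse_eq_inv']
  exact (hcov.matrix_det.inv₀ fun z => (isUnit_det_smul_one_add ht
    (posSemidef_sum_smul_vecMulVec J z)).ne_zero).smul hcov.matrix_adjugate

theorem continuous_resolventTrace (ht : 0 < t) :
    Continuous fun z : Fin p → ι → ℝ => resolventTrace t z :=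
  (continuous_columnResolvent ht _).matrix_trace.div_const _

theorem continuous_leaveOneOutForm (ht : 0 < t) (j : Fin p) :
    Continuous fun z : Fin p → ι → ℝ => leaveOneOutForm t j z := by
  have hcol : Continuous fun z : Fin p → ι → ℝ => z j := continuous_apply j
  exact continuous_const.mul
    (hcol.dotProduct ((continuous_columnResolvent ht _).matrix_mulVec hcol))

theorem resolventTrace_nonneg (ht : 0 < t) (z : Fin p → ι → ℝ) : 0 ≤ resolventTrace t z :=
  div_nonneg
    (posDef_shiftedInv ht (posSemidef_sum_smul_vecMulVec _ z)).posSemidef.trace_nonneg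
    (Nat.cast_nonneg _)

theorem resolventTrace_le (ht : 0 < t) (z : Fin p → ι → ℝ) : resolventTrace t z ≤ 1 / t :=
  div_le_of_le_mul₀ (Nat.cast_nonneg _) (by positivity) <|
    (trace_shiftedInv_le ht (posSemidef_sum_smul_vecMulVec _ z)).trans_eq (mul_comm _ _)

theorem leaveOneOutForm_nonneg (ht : 0 < t) (j : Fin p) (z : Fin p → ι → ℝ) :
    0 ≤ leaveOneOutForm t j z := by
  have h := (posDef_shiftedInv ht (posSemidef_sum_smul_vecMulVec
    (Finset.univ.erase j) z)).posSemidef.dotProduct_mulVec_nonneg (z j)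
  exact mul_nonneg (by positivity) h

theorem trace_columnResolvent_erase_sub_trace_mem_Icc (ht : 0 < t) (j : Fin p)
    (z : Fin p → ι → ℝ) :
    (columnResolvent t (Finset.univ.erase j) z).trace -
      (columnResolvent t Finset.univ z).trace ∈ Set.Icc 0 (1 / t) := by
  rw [columnResolvent_univ t j z]
  exact trace_shiftedInv_sub_trace_mem_Icc (z j) ht (posSemidef_sum_smul_vecMulVec _ z)
    (by positivity)

theorem abs_resolventTrace_sub_update_le (ht : 0 < t) (j : Fin p) (z : Fin p → ι → ℝ)
    (w : ι → ℝ) :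
    |resolventTrace t z - resolventTrace t (Function.update z j w)| ≤
      1 / t / Fintype.card ι := by
  have hz := trace_columnResolvent_erase_sub_trace_mem_Icc ht j z
  have hw := trace_columnResolvent_erase_sub_trace_mem_Icc ht j (Function.update z j w)
  rw [columnResolvent_erase_update] at hw
  rw [resolventTrace, resolventTrace, ← sub_div, abs_div, Nat.abs_cast]
  gcongr
  rw [abs_le]
  constructor <;> linarith [hz.1, hz.2, hw.1, hw.2]

/-- The identity `N - t tr R = tr (R S)`, with the contribution of each column to the right-hand
side rewritten by the Sherman–Morrison formula. -/
theorem card_sub_mul_trace_eq_sum (ht : 0 < t) (z : Fin p → ι → ℝ) :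
    Fintype.card ι - t * (columnResolvent t Finset.univ z).trace =
      ∑ j, (1 - 1 / (1 + leaveOneOutForm t j z)) := by
  have hS := posSemidef_sum_smul_vecMulVec Finset.univ z
  have hcol (j : Fin p) : (columnResolvent t Finset.univ z *
      ((1 / (p : ℝ)) • vecMulVec (z j) (z j))).trace = 1 - 1 / (1 + leaveOneOutForm t j z) := by
    rw [mul_smul_comm, trace_smul, mul_vecMulVec, trace_vecMulVec, dotProduct_comm,
      smul_eq_mul, columnResolvent_univ t j z]
    exact mul_quadForm_shiftedInv_add_smul_vecMulVec (z j) ht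
      (posSemidef_sum_smul_vecMulVec _ z) (by positivity)
  rw [← Finset.sum_congr rfl fun j _ => hcol j, ← trace_sum, ← Finset.mul_sum, columnResolvent,
    shiftedInv_mul_self ht hS, trace_sub, trace_one, trace_smul, smul_eq_mul]

theorem eigenvalues_sampleCov_nonneg (Z : Matrix ι (Fin p) ℝ) (i : ι) :
    0 ≤ (sampleCov_isHermitian Z).eigenvalues i :=
  ((sum_smul_vecMulVec_eq_sampleCov Z) ▸
    posSemidef_sum_smul_vecMulVec Finset.univ Z.col).eigenvalues_nonneg i

theorem resolventTrace_col_eq_sum (ht : 0 < t) (Z : Matrix ι (Fin p) ℝ) :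
    resolventTrace t Z.col =
      (∑ i, 1 / (t + (sampleCov_isHermitian Z).eigenvalues i)) / Fintype.card ι := by
  rw [resolventTrace, columnResolvent, sum_smul_vecMulVec_eq_sampleCov,
    trace_shiftedInv_eq_sum_eigenvalues (sampleCov_isHermitian Z) fun i =>
      (add_pos_of_pos_of_nonneg ht (eigenvalues_sampleCov_nonneg Z i)).ne']

end ColumnResolvent

end Resolvent

section BoundedDifferences

open scoped NNReal

theorem lintegral_pi_eq_lintegral_lintegral_update {κ : Type*} [Fintype κ] [DecidableEq κ]
    {X : κ → Type*} [∀ i, MeasurableSpace (X i)] (ν : ∀ i, Measure (X i))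
    [∀ i, IsProbabilityMeasure (ν i)] (j : κ) {f : (∀ i, X i) → ENNReal} (hf : Measurable f) :
    ∫⁻ z, f z ∂Measure.pi ν = ∫⁻ z, ∫⁻ w, f (Function.update z j w) ∂ν j ∂Measure.pi ν := by
  have hmarginal : (fun z => ∫⁻ w, f (Function.update z j w) ∂ν j) = ∫⋯∫⁻_{j}, f ∂ν :=
    (lmarginal_singleton f j).symm
  rw [hmarginal]
  refine lintegral_eq_of_lmarginal_eq {j} hf (hf.lmarginal ν) ?_
  funext z
  simp only [lmarginal_singleton, Function.update_idem, lintegral_const, measure_univ, mul_one]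

theorem hasSubgaussianMGF_prod_add {X Y : Type*} [MeasurableSpace X] [MeasurableSpace Y]
    {μ : Measure X} {ν : Measure Y} [SFinite μ] [IsProbabilityMeasure ν] {F : X → Y → ℝ}
    {G : Y → ℝ} {a b : ℝ≥0} (hFm : Measurable (Function.uncurry F))
    (hF : ∀ y, HasSubgaussianMGF (fun x => F x y) a μ) (hG : HasSubgaussianMGF G b ν) :
    HasSubgaussianMGF (fun q : X × Y => F q.1 q.2 + G q.2) (a + b) (μ.prod ν) := by
  have hinner (l : ℝ) (y : Y) : ∫ x, Real.exp (l * (F x y + G y)) ∂μ ≤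
      Real.exp (a * l ^ 2 / 2) * Real.exp (l * G y) := by
    simp only [mul_add, Real.exp_add, integral_mul_const]
    exact mul_le_mul_of_nonneg_right ((hF y).mgf_le l) (Real.exp_pos _).le
  have hint (l : ℝ) : Integrable (fun q : X × Y => Real.exp (l * (F q.1 q.2 + G q.2)))
      (μ.prod ν) := by
    have hmeas : AEStronglyMeasurable (fun q : X × Y => Real.exp (l * (F q.1 q.2 + G q.2)))
        (μ.prod ν) :=
      (((hFm.aemeasurable.add hG.aemeasurable.comp_snd).const_mul l).exp).aestronglyMeasurable
    rw [integrable_prod_iff' hmeas]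
    refine ⟨ae_of_all _ fun y => ?_, ((hG.integrable_exp_mul l).const_mul
      (Real.exp (a * l ^ 2 / 2))).mono' hmeas.norm.prod_swap.integral_prod_right'
        (ae_of_all _ fun y => ?_)⟩
    · simp only [mul_add, Real.exp_add]
      exact ((hF y).integrable_exp_mul l).mul_const _
    · simp only [Real.norm_eq_abs, Real.abs_exp]
      rw [abs_of_nonneg (integral_nonneg fun x => (Real.exp_pos _).le)]
      exact hinner l y
  refine ⟨hint, fun l => ?_⟩
  calc mgf (fun q : X × Y => F q.1 q.2 + G q.2) (μ.prod ν) l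
      = ∫ y, ∫ x, Real.exp (l * (F x y + G y)) ∂μ ∂ν := integral_prod_symm _ (hint l)
    _ ≤ ∫ y, Real.exp (a * l ^ 2 / 2) * Real.exp (l * G y) ∂ν :=
        integral_mono_of_nonneg (ae_of_all _ fun y => integral_nonneg fun x => (Real.exp_pos _).le)
          ((hG.integrable_exp_mul l).const_mul _) (ae_of_all _ (hinner l))
    _ = Real.exp (a * l ^ 2 / 2) * mgf G ν l := integral_const_mul _ _
    _ ≤ Real.exp (a * l ^ 2 / 2) * Real.exp (b * l ^ 2 / 2) :=
        mul_le_mul_of_nonneg_left (hG.mgf_le l) (Real.exp_pos _).le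
    _ = Real.exp ((a + b : ℝ≥0) * l ^ 2 / 2) := by
        rw [← Real.exp_add, NNReal.coe_add]
        ring_nf

theorem hasSubgaussianMGF_sub_integral_of_abs_sub_le {X : Type*} [MeasurableSpace X]
    {μ : Measure X} [IsProbabilityMeasure μ] {f : X → ℝ} (hf : Measurable f) {c : ℝ≥0}
    (hc : ∀ x w, |f x - f w| ≤ c) : HasSubgaussianMGF (fun x => f x - ∫ w, f w ∂μ) (c ^ 2) μ := by
  obtain ⟨x₀⟩ := μ.nonempty_of_neZero
  have hmem (x : X) : f x ∈ Set.Icc (f x₀ - c) (f x₀ + c) :=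
    ⟨by linarith [(abs_le.1 (hc x₀ x)).2], by linarith [(abs_le.1 (hc x x₀)).2]⟩
  have hparam : (‖f x₀ + c - (f x₀ - c)‖₊ / 2) ^ 2 = c ^ 2 := by
    rw [add_sub_sub_cancel, ← two_mul, nnnorm_mul]
    simp
  exact hparam ▸ hasSubgaussianMGF_of_mem_Icc hf.aemeasurable (ae_of_all _ hmem)

theorem integrable_of_abs_sub_le {X : Type*} [MeasurableSpace X] {μ : Measure X}
    [IsFiniteMeasure μ] {f : X → ℝ} (hf : Measurable f) {c : ℝ} (hc : ∀ x w, |f x - f w| ≤ c) :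
    Integrable f μ := by
  cases isEmpty_or_nonempty X with
  | inl _ => rw [Measure.eq_zero_of_isEmpty μ]; exact integrable_zero_measure
  | inr hX =>
    obtain ⟨x₀⟩ := hX
    refine Integrable.of_bound hf.aestronglyMeasurable (c + |f x₀|) (ae_of_all _ fun x => ?_)
    linarith [abs_sub_abs_le_abs_sub (f x) (f x₀), hc x x₀, Real.norm_eq_abs (f x)]

theorem hasSubgaussianMGF_prod_sub_integral {X Y : Type*} [MeasurableSpace X] [MeasurableSpace Y]
    {μ : Measure X} {ν : Measure Y} [IsProbabilityMeasure μ] [IsProbabilityMeasure ν]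
    {F : X → Y → ℝ} {a b : ℝ≥0} (hF : Measurable (Function.uncurry F))
    (ha : ∀ y x w, |F x y - F w y| ≤ a)
    (hb : HasSubgaussianMGF (fun y => ∫ x, F x y ∂μ - ∫ y, ∫ x, F x y ∂μ ∂ν) b ν) :
    HasSubgaussianMGF (fun q : X × Y => F q.1 q.2 - ∫ q : X × Y, F q.1 q.2 ∂μ.prod ν) (a ^ 2 + b)
      (μ.prod ν) := by
  have hFy (y : Y) : Measurable fun x => F x y := hF.comp (measurable_id.prodMk measurable_const)
  have hmean : Measurable fun y => ∫ x, F x y ∂μ :=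
    hF.stronglyMeasurable.integral_prod_left'.measurable
  have hsub := hasSubgaussianMGF_prod_add (F := fun x y => F x y - ∫ x, F x y ∂μ)
    (hF.sub (hmean.comp measurable_snd))
    (fun y => hasSubgaussianMGF_sub_integral_of_abs_sub_le (hFy y) (ha y)) hb
  simp only [sub_add_sub_cancel] at hsub
  have hint : Integrable (fun q : X × Y => F q.1 q.2) (μ.prod ν) := by
    simpa only [Pi.add_def, sub_add_cancel] using
      hsub.integrable.add (integrable_const (∫ y, ∫ x, F x y ∂μ ∂ν))
  rwa [integral_prod_symm _ hint]

/-- McDiarmid's bounded difference inequality, in its sub-Gaussian form. -/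
theorem hasSubgaussianMGF_pi_of_bounded_differences {p : ℕ} {X : Fin p → Type*}
    [∀ i, MeasurableSpace (X i)] (ν : ∀ i, Measure (X i)) [∀ i, IsProbabilityMeasure (ν i)]
    {f : (∀ i, X i) → ℝ} (hf : Measurable f) {c : Fin p → ℝ≥0}
    (hc : ∀ z j w, |f z - f (Function.update z j w)| ≤ c j) :
    HasSubgaussianMGF (fun z => f z - ∫ y, f y ∂Measure.pi ν) (∑ j, c j ^ 2) (Measure.pi ν) := by
  induction p with
  | zero =>
    have hconst (z : ∀ i, X i) : f z = f default := congrArg f (Subsingleton.elim z default)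
    simp [hconst]
  | succ p ih =>
    set e := MeasurableEquiv.piFinSuccAbove X 0
    have he : MeasurePreserving e (Measure.pi ν)
        ((ν 0).prod (Measure.pi fun j => ν (Fin.succAbove 0 j))) :=
      measurePreserving_piFinSuccAbove ν 0
    set F : X 0 → (∀ j, X (Fin.succAbove 0 j)) → ℝ := fun x y => f (e.symm (x, y))
    have hFm : Measurable (Function.uncurry F) := hf.comp e.symm.measurable
    have hFx (y) (x w) : |F x y - F w y| ≤ c 0 := by
      have := hc (Fin.insertNth 0 x y) 0 w
      rwa [Fin.update_insertNth] at this
    have hFi (y) : Integrable (fun x => F x y) (ν 0) :=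
      integrable_of_abs_sub_le (hFm.comp (measurable_id.prodMk measurable_const)) (hFx y)
    have hmean (y j w) : |∫ x, F x y ∂ν 0 - ∫ x, F x (Function.update y j w) ∂ν 0| ≤
        c (Fin.succAbove 0 j) := by
      have hstep (x : X 0) : ‖F x y - F x (Function.update y j w)‖ ≤ c (Fin.succAbove 0 j) := by
        have := hc (Fin.insertNth 0 x y) (Fin.succAbove 0 j) w
        rwa [← Fin.insertNth_update] at this
      rw [← integral_sub (hFi _) (hFi _)]
      simpa using norm_integral_le_of_norm_le_const (μ := ν 0) (ae_of_all _ hstep)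
    have hsub := hasSubgaussianMGF_prod_sub_integral hFm hFx
      (ih (fun j => ν (Fin.succAbove 0 j)) hFm.stronglyMeasurable.integral_prod_left'.measurable
        hmean)
    have hFe (z : ∀ i, X i) : F (e z).1 (e z).2 = f z := congrArg f (e.symm_apply_apply z)
    rw [← he.integral_comp', ← he.map_eq] at hsub
    simpa only [Function.comp_def, hFe, Fin.sum_univ_succAbove _ 0] using
      hsub.of_map he.aemeasurable

theorem measureReal_abs_ge_le_of_hasSubgaussianMGF {X : Type*} [MeasurableSpace X]
    {μ : Measure X} {f : X → ℝ} {c : ℝ≥0} (h : HasSubgaussianMGF f c μ) {ε : ℝ} (hε : 0 ≤ ε) :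
    μ.real {x | ε ≤ |f x|} ≤ 2 * Real.exp (-ε ^ 2 / (2 * c)) := by
  have hsplit : {x | ε ≤ |f x|} = {x | ε ≤ f x} ∪ {x | ε ≤ (-f) x} := by
    ext x
    exact le_abs (a := ε)
  rw [hsplit, two_mul]
  exact (measureReal_union_le _ _).trans
    (add_le_add (h.measure_ge_le hε) (h.neg.measure_ge_le hε))

end BoundedDifferences

section SelfConsistent

open Matrix

variable {ι : Type*} [Fintype ι] [DecidableEq ι] {p : ℕ} {t : ℝ}

/-- The quadratic forms `zᵀ A z` of a random vector `z` with law `ν` have mean square deviation from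
`tr A` at most `δ N²`, where `N` is the dimension, for all matrices `A` whose rows have Euclidean
norm at most `1`. -/
def QuadFormVarianceLE (ν : Measure (ι → ℝ)) (δ : ℝ) : Prop :=
  ∀ A : Matrix ι ι ℝ, (∀ s, ∑ u, A s u ^ 2 ≤ 1) →
    ∫⁻ z, ENNReal.ofReal ((z ⬝ᵥ A *ᵥ z - A.trace) ^ 2) ∂ν ≤
      ENNReal.ofReal (Fintype.card ι ^ 2 * δ)

/-- The value `p⁻¹ tr R⁽ʲ⁾` around which `leaveOneOutForm t j` concentrates. -/
def leaveOneOutTrace (t : ℝ) (j : Fin p) (z : Fin p → ι → ℝ) : ℝ :=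
  1 / (p : ℝ) * (columnResolvent t (Finset.univ.erase j) z).trace

theorem continuous_leaveOneOutForm_sub_leaveOneOutTrace (ht : 0 < t) (j : Fin p) :
    Continuous fun z : Fin p → ι → ℝ => leaveOneOutForm t j z - leaveOneOutTrace t j z :=
  (continuous_leaveOneOutForm ht j).sub
    (continuous_const.mul (continuous_columnResolvent ht _).matrix_trace)

theorem abs_resolventTrace_le (ht : 0 < t) (z : Fin p → ι → ℝ) : |resolventTrace t z| ≤ 1 / t :=
  (abs_of_nonneg (resolventTrace_nonneg ht z)).trans_le (resolventTrace_le ht z)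

omit [DecidableEq ι] in
theorem QuadFormVarianceLE.lintegral_sq_sub_le {ν : Measure (ι → ℝ)} {δ : ℝ}
    (h : QuadFormVarianceLE ν δ) (ht : 0 < t) {c : ℝ} {A : Matrix ι ι ℝ}
    (hA : ∀ s, ∑ u, A s u ^ 2 ≤ (1 / t) ^ 2) :
    ∫⁻ z, ENNReal.ofReal ((c * (z ⬝ᵥ A *ᵥ z) - c * A.trace) ^ 2) ∂ν ≤
      ENNReal.ofReal ((c * Fintype.card ι) ^ 2 * (1 / t) ^ 2 * δ) := by
  have hrow (s : ι) : ∑ u, (t • A) s u ^ 2 ≤ 1 := by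
    simp only [Matrix.smul_apply, smul_eq_mul, mul_pow, ← Finset.mul_sum]
    calc t ^ 2 * ∑ u, A s u ^ 2 ≤ t ^ 2 * (1 / t) ^ 2 := by gcongr; exact hA s
      _ = 1 := by field_simp
  have hscale (z : ι → ℝ) : (c * (z ⬝ᵥ A *ᵥ z) - c * A.trace) ^ 2 =
      (c / t) ^ 2 * (z ⬝ᵥ (t • A) *ᵥ z - (t • A).trace) ^ 2 := by
    rw [smul_mulVec, dotProduct_smul, trace_smul, smul_eq_mul, smul_eq_mul]
    field_simp
  simp only [hscale, ENNReal.ofReal_mul (sq_nonneg (c / t))]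
  rw [lintegral_const_mul' _ _ ENNReal.ofReal_ne_top]
  refine (mul_le_mul_right (h (t • A) hrow) _).trans_eq ?_
  rw [← ENNReal.ofReal_mul (sq_nonneg _)]
  ring_nf

theorem lintegral_leaveOneOutForm_sub_trace_sq_le {ν : Fin p → Measure (ι → ℝ)}
    [∀ j, IsProbabilityMeasure (ν j)] {δ : ℝ} (j : Fin p) (h : QuadFormVarianceLE (ν j) δ)
    (ht : 0 < t) :
    ∫⁻ z, ENNReal.ofReal ((leaveOneOutForm t j z - leaveOneOutTrace t j z) ^ 2) ∂Measure.pi ν ≤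
      ENNReal.ofReal ((Fintype.card ι / p) ^ 2 * (1 / t) ^ 2 * δ) := by
  rw [lintegral_pi_eq_lintegral_lintegral_update ν j
    ((continuous_leaveOneOutForm_sub_leaveOneOutTrace ht j).fun_pow 2).measurable.ennreal_ofReal,
    ← one_div_mul_eq_div]
  refine (lintegral_mono fun z => ?_).trans_eq <|
    (lintegral_const _).trans <| by rw [measure_univ, mul_one]
  simp only [leaveOneOutForm, leaveOneOutTrace, columnResolvent_erase_update, Function.update_self]
  exact h.lintegral_sq_sub_le ht (sum_sq_shiftedInv_le ht (posSemidef_sum_smul_vecMulVec _ z))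

theorem integrable_and_integral_abs_le_sqrt {X : Type*} [MeasurableSpace X] {π : Measure X}
    [IsProbabilityMeasure π] {Y : X → ℝ} (hY : AEStronglyMeasurable Y π) {B : ℝ}
    (h : ∫⁻ x, ENNReal.ofReal (Y x ^ 2) ∂π ≤ ENNReal.ofReal B) :
    Integrable Y π ∧ ∫ x, |Y x| ∂π ≤ √B := by
  have hnonneg : 0 ≤ᵐ[π] fun x => Y x ^ 2 := ae_of_all _ fun x => sq_nonneg _
  have hsq : Integrable (fun x => Y x ^ 2) π :=
    ⟨hY.pow 2, (hasFiniteIntegral_iff_ofReal hnonneg).2 (h.trans_lt ENNReal.ofReal_lt_top)⟩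
  have hmem : MemLp Y 2 π := (memLp_two_iff_integrable_sq hY).2 hsq
  have hle : ∫ x, Y x ^ 2 ∂π ≤ B.toNNReal := by
    rw [integral_eq_lintegral_of_nonneg_ae hnonneg hsq.aestronglyMeasurable]
    exact ENNReal.toReal_mono ENNReal.ofReal_ne_top h
  have hvar := variance_nonneg |Y| π
  rw [variance_eq_sub hmem.abs] at hvar
  refine ⟨hmem.integrable one_le_two, ?_⟩
  simp only [Pi.pow_apply, Pi.abs_apply, sq_abs] at hvar
  refine (le_abs_self _).trans ((Real.abs_le_sqrt ((sub_nonneg.1 hvar).trans hle)).trans_eq ?_)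
  rw [Real.sqrt, Real.sqrt, Real.toNNReal_coe]

theorem abs_one_div_one_add_sub_le {a b : ℝ} (ha : 0 ≤ a) (hb : 0 ≤ b) :
    |1 / (1 + a) - 1 / (1 + b)| ≤ |a - b| := by
  have hsub : 1 / (1 + a) - 1 / (1 + b) = (b - a) / ((1 + a) * (1 + b)) := by
    field_simp
    ring
  rw [hsub, abs_div, abs_sub_comm b a, abs_of_pos (by positivity : 0 < (1 + a) * (1 + b))]
  exact div_le_self (abs_nonneg _) (by nlinarith [mul_nonneg ha hb])

theorem abs_one_div_one_add_leaveOneOutForm_sub_le [Nonempty ι] (ht : 0 < t) (j : Fin p)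
    {m : ℝ} (hm : 0 ≤ m) (z : Fin p → ι → ℝ) :
    |1 / (1 + leaveOneOutForm t j z) - 1 / (1 + Fintype.card ι / p * m)| ≤
      |leaveOneOutForm t j z - leaveOneOutTrace t j z| + 1 / t / p +
        Fintype.card ι / p * |resolventTrace t z - m| := by
  have hcard : (Fintype.card ι : ℝ) ≠ 0 := Nat.cast_ne_zero.2 Fintype.card_ne_zero
  have hg : (0 : ℝ) ≤ Fintype.card ι / p := by positivity
  have htrace : |leaveOneOutTrace t j z - Fintype.card ι / p * resolventTrace t z| ≤
      1 / t / p := by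
    have hdiff : leaveOneOutTrace t j z - Fintype.card ι / p * resolventTrace t z =
        ((columnResolvent t (Finset.univ.erase j) z).trace -
          (columnResolvent t Finset.univ z).trace) / p := by
      rw [leaveOneOutTrace, resolventTrace]
      field_simp
    have hIcc := trace_columnResolvent_erase_sub_trace_mem_Icc ht j z
    rw [hdiff, abs_div, Nat.abs_cast, abs_of_nonneg hIcc.1]
    gcongr
    exact hIcc.2
  have hdev : Fintype.card ι / p * |resolventTrace t z - m| =
      |Fintype.card ι / p * resolventTrace t z - Fintype.card ι / p * m| := by
    rw [← mul_sub, abs_mul, abs_of_nonneg hg]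
  calc |1 / (1 + leaveOneOutForm t j z) - 1 / (1 + Fintype.card ι / p * m)|
      ≤ |leaveOneOutForm t j z - Fintype.card ι / p * m| :=
        abs_one_div_one_add_sub_le (leaveOneOutForm_nonneg ht j z) (mul_nonneg hg hm)
    _ ≤ _ := by
      rw [hdev]
      linarith [abs_sub_le (leaveOneOutForm t j z) (leaveOneOutTrace t j z)
          (Fintype.card ι / p * m),
        abs_sub_le (leaveOneOutTrace t j z) (Fintype.card ι / p * resolventTrace t z)
          (Fintype.card ι / p * m)]

theorem card_div_mul_sub_eq_average [Nonempty ι] (ht : 0 < t) (hp : p ≠ 0) (b : ℝ)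
    (z : Fin p → ι → ℝ) :
    Fintype.card ι / p * (1 - t * resolventTrace t z) - (1 - b) =
      1 / p * ∑ j, (b - 1 / (1 + leaveOneOutForm t j z)) := by
  have hp' : (p : ℝ) ≠ 0 := Nat.cast_ne_zero.2 hp
  have hcard : (Fintype.card ι : ℝ) ≠ 0 := Nat.cast_ne_zero.2 Fintype.card_ne_zero
  have hsum := card_sub_mul_trace_eq_sum ht z
  simp only [Finset.sum_sub_distrib, Finset.sum_const, Finset.card_univ, Fintype.card_fin,
    nsmul_eq_mul, mul_one] at hsum ⊢
  rw [resolventTrace]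
  field_simp
  linear_combination hsum

section Integrals

variable {ν : Fin p → Measure (ι → ℝ)} [∀ j, IsProbabilityMeasure (ν j)]

theorem integrable_resolventTrace (ht : 0 < t) :
    Integrable (fun z : Fin p → ι → ℝ => resolventTrace t z) (Measure.pi ν) :=
  Integrable.of_bound (continuous_resolventTrace ht).measurable.aestronglyMeasurable (1 / t)
    (ae_of_all _ fun z => abs_resolventTrace_le ht z)

theorem abs_integral_resolventTrace_le (ht : 0 < t) :
    |∫ z, resolventTrace t z ∂Measure.pi ν| ≤ 1 / t := by
  simpa using norm_integral_le_of_norm_le_const (μ := Measure.pi ν)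
    (f := fun z => resolventTrace t z) (ae_of_all _ (abs_resolventTrace_le ht))

theorem integrable_one_div_one_add_leaveOneOutForm (ht : 0 < t) (j : Fin p) :
    Integrable (fun z : Fin p → ι → ℝ => 1 / (1 + leaveOneOutForm t j z)) (Measure.pi ν) := by
  refine Integrable.of_bound ((measurable_const.add
    (continuous_leaveOneOutForm ht j).measurable).const_div 1).aestronglyMeasurable 1
    (ae_of_all _ fun z => ?_)
  have hz := leaveOneOutForm_nonneg ht j z
  rw [Real.norm_eq_abs, abs_of_nonneg (by positivity)]
  exact div_le_one_of_le₀ (by linarith) (by positivity)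

theorem integral_abs_one_div_one_add_leaveOneOutForm_sub_le [Nonempty ι] {δ : ℝ} (j : Fin p)
    (h : QuadFormVarianceLE (ν j) δ) (ht : 0 < t) {m : ℝ} (hm : 0 ≤ m) :
    ∫ z, |1 / (1 + leaveOneOutForm t j z) - 1 / (1 + Fintype.card ι / p * m)| ∂Measure.pi ν ≤
      √((Fintype.card ι / p) ^ 2 * (1 / t) ^ 2 * δ) + 1 / t / p +
        Fintype.card ι / p * ∫ z, |resolventTrace t z - m| ∂Measure.pi ν := by
  obtain ⟨hint, hle⟩ := integrable_and_integral_abs_le_sqrt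
    (continuous_leaveOneOutForm_sub_leaveOneOutTrace ht j).measurable.aestronglyMeasurable
    (lintegral_leaveOneOutForm_sub_trace_sq_le j h ht)
  have hdev : Integrable (fun z => |resolventTrace t z - m|) (Measure.pi ν) :=
    ((integrable_resolventTrace ht).sub' (integrable_const m)).abs
  calc ∫ z, |1 / (1 + leaveOneOutForm t j z) - 1 / (1 + Fintype.card ι / p * m)| ∂Measure.pi ν
      ≤ ∫ z, (|leaveOneOutForm t j z - leaveOneOutTrace t j z| + 1 / t / p +
          Fintype.card ι / p * |resolventTrace t z - m|) ∂Measure.pi ν :=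
        integral_mono ((integrable_one_div_one_add_leaveOneOutForm ht j).sub'
          (integrable_const _)).abs
          ((hint.abs.fun_add (integrable_const _)).fun_add (hdev.const_mul _))
          (abs_one_div_one_add_leaveOneOutForm_sub_le ht j hm)
    _ = ∫ z, |leaveOneOutForm t j z - leaveOneOutTrace t j z| ∂Measure.pi ν + 1 / t / p +
          Fintype.card ι / p * ∫ z, |resolventTrace t z - m| ∂Measure.pi ν := by
        rw [integral_add (hint.abs.fun_add (integrable_const _)) (hdev.const_mul _),
          integral_add hint.abs (integrable_const _), integral_const_mul, integral_const,
          probReal_univ, one_smul]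
    _ ≤ _ := by gcongr

theorem abs_selfConsistent_le [Nonempty ι] {δ : ℝ} (h : ∀ j, QuadFormVarianceLE (ν j) δ)
    (ht : 0 < t) (hp : p ≠ 0) {m : ℝ} (hm : ∫ z, resolventTrace t z ∂Measure.pi ν = m) :
    |Fintype.card ι / p * (1 - t * m) - (1 - 1 / (1 + Fintype.card ι / p * m))| ≤
      √((Fintype.card ι / p) ^ 2 * (1 / t) ^ 2 * δ) + 1 / t / p +
        Fintype.card ι / p * ∫ z, |resolventTrace t z - m| ∂Measure.pi ν := by
  have hm0 : 0 ≤ m := hm ▸ integral_nonneg fun z => resolventTrace_nonneg ht z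
  set b : ℝ := 1 / (1 + Fintype.card ι / p * m)
  set B : ℝ := √((Fintype.card ι / p) ^ 2 * (1 / t) ^ 2 * δ) + 1 / t / p +
    Fintype.card ι / p * ∫ z, |resolventTrace t z - m| ∂Measure.pi ν
  have hint (j : Fin p) : Integrable (fun z => b - 1 / (1 + leaveOneOutForm t j z))
      (Measure.pi ν) :=
    (integrable_const b).sub' (integrable_one_div_one_add_leaveOneOutForm ht j)
  have hmean : Fintype.card ι / p * (1 - t * m) - (1 - b) =
      1 / p * ∑ j, ∫ z, (b - 1 / (1 + leaveOneOutForm t j z)) ∂Measure.pi ν := by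
    have htr := (integrable_resolventTrace (ν := ν) ht).const_mul t
    rw [← integral_finsetSum _ fun j _ => hint j, ← integral_const_mul]
    simp only [← card_div_mul_sub_eq_average ht hp]
    rw [integral_sub (((integrable_const _).sub' htr).const_mul _) (integrable_const _),
      integral_const_mul, integral_sub (integrable_const _) htr, integral_const_mul, hm]
    simp
  have hcol (j : Fin p) : |∫ z, (b - 1 / (1 + leaveOneOutForm t j z)) ∂Measure.pi ν| ≤ B := by
    refine abs_integral_le_integral_abs.trans ?_
    simp only [abs_sub_comm b]
    exact integral_abs_one_div_one_add_leaveOneOutForm_sub_le j (h j) ht hm0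
  calc |Fintype.card ι / p * (1 - t * m) - (1 - b)|
      = 1 / p * |∑ j, ∫ z, (b - 1 / (1 + leaveOneOutForm t j z)) ∂Measure.pi ν| := by
        rw [hmean, abs_mul, abs_of_nonneg (by positivity : (0 : ℝ) ≤ 1 / p)]
    _ ≤ 1 / p * ∑ _j : Fin p, B := by
        gcongr
        exact (Finset.abs_sum_le_sum_abs _ _).trans (Finset.sum_le_sum fun j _ => hcol j)
    _ = B := by
        have hp' : (p : ℝ) ≠ 0 := Nat.cast_ne_zero.2 hp
        simp [hp']

end Integrals

theorem eq_of_selfConsistent {γ m m₀ : ℝ} (hγ : 0 < γ) (ht : 0 < t) (hm : 0 ≤ m) (hm₀ : 0 < m₀)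
    (h₀ : γ * t * m₀ ^ 2 + (t + 1 - γ) * m₀ - 1 = 0)
    (h : γ * (1 - t * m) - (1 - 1 / (1 + γ * m)) = 0) : m = m₀ := by
  have hden : 1 + γ * m ≠ 0 := by positivity
  have hquad : γ * t * m ^ 2 + (t + 1 - γ) * m - 1 = 0 := by
    field_simp at h
    have hfactor : γ * (γ * t * m ^ 2 + (t + 1 - γ) * m - 1) = 0 := by linear_combination -h
    exact (mul_eq_zero.1 hfactor).resolve_left hγ.ne'
  have hprod : (m - m₀) * (γ * t * m * m₀ + 1) = 0 := by
    linear_combination m₀ * hquad - m * h₀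
  exact sub_eq_zero.1 ((mul_eq_zero.1 hprod).resolve_right (by positivity))

theorem tendsto_of_selfConsistent {γ b m₀ : ℝ} (hγ : 0 < γ) (ht : 0 < t) (hm₀ : 0 < m₀)
    (h₀ : γ * t * m₀ ^ 2 + (t + 1 - γ) * m₀ - 1 = 0) {g m : ℕ → ℝ}
    (hg : Tendsto g atTop (𝓝 γ)) (hm : ∀ n, m n ∈ Set.Icc 0 b)
    (h : Tendsto (fun n => g n * (1 - t * m n) - (1 - 1 / (1 + g n * m n))) atTop (𝓝 0)) :
    Tendsto m atTop (𝓝 m₀) := by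
  refine isCompact_Icc.tendsto_nhds_of_unique_mapClusterPt (.of_forall hm) fun y hy hcluster => ?_
  obtain ⟨U, hU, hmU⟩ := mapClusterPt_iff_ultrafilter.1 hcluster
  have hgU := hg.mono_left hU
  have hden : 1 + γ * y ≠ 0 := by have := hy.1; positivity
  have hlim : Tendsto (fun n => g n * (1 - t * m n) - (1 - 1 / (1 + g n * m n))) U
      (𝓝 (γ * (1 - t * y) - (1 - 1 / (1 + γ * y)))) :=
    (hgU.mul ((hmU.const_mul t).const_sub 1)).sub
      ((tendsto_const_nhds.div ((hgU.mul hmU).const_add 1) hden).const_sub 1)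
  exact eq_of_selfConsistent hγ ht hy.1 hm₀ h₀ (tendsto_nhds_unique hlim (h.mono_left hU))

end SelfConsistent

section ResolventConvergence

theorem ae_tendsto_zero_of_summable_measureReal {Ω : Type*} [MeasurableSpace Ω] {P : Measure Ω}
    [IsFiniteMeasure P] {Y : ℕ → Ω → ℝ}
    (h : ∀ ε > 0, Summable fun n => P.real {ω | ε ≤ |Y n ω|}) :
    ∀ᵐ ω ∂P, Tendsto (fun n => Y n ω) atTop (𝓝 0) := by
  suffices hball : ∀ k : ℕ, ∀ᵐ ω ∂P, ∀ᶠ n in atTop, Y n ω ∈ Metric.ball 0 (1 / ((k : ℝ) + 1)) by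
    filter_upwards [ae_all_iff.2 hball] with ω hω
    exact Metric.nhds_basis_ball_inv_nat_succ.tendsto_right_iff.2 fun k _ => hω k
  intro k
  have hsum := (h (1 / ((k : ℝ) + 1)) (by positivity)).tsum_ofReal_ne_top
  simp only [measureReal_def, ENNReal.ofReal_toReal (measure_ne_top P _)] at hsum
  filter_upwards [ae_eventually_notMem hsum] with ω hω
  filter_upwards [hω] with n hn
  rw [mem_ball_zero_iff]
  exact not_le.1 hn

theorem measureReal_abs_resolventTrace_sub_integral_ge_le {ι : Type*} [Fintype ι] [DecidableEq ι]
    {p : ℕ} (ν : Fin p → Measure (ι → ℝ)) [∀ j, IsProbabilityMeasure (ν j)] {t ε : ℝ} (ht : 0 < t)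
    (hε : 0 ≤ ε) :
    (Measure.pi ν).real
        {z | ε ≤ |resolventTrace t z - ∫ y, resolventTrace t y ∂Measure.pi ν|} ≤
      2 * Real.exp (-(ε ^ 2 * t ^ 2 / 2 * (Fintype.card ι / p) * Fintype.card ι)) := by
  set c : NNReal := ⟨1 / t / Fintype.card ι, by positivity⟩
  have hsub := hasSubgaussianMGF_pi_of_bounded_differences ν
    (continuous_resolventTrace ht).measurable (c := fun _ => c)
    fun z j w => abs_resolventTrace_sub_update_le ht j z w
  refine (measureReal_abs_ge_le_of_hasSubgaussianMGF hsub hε).trans_eq ?_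
  have hc : (c : ℝ) = 1 / t / Fintype.card ι := rfl
  congr 2
  push_cast
  rw [Finset.sum_const, Finset.card_univ, Fintype.card_fin, nsmul_eq_mul, hc]
  simp only [div_eq_mul_inv, mul_inv, inv_inv, one_mul, inv_pow, mul_pow]
  ring

variable {Ω : Type*} [MeasurableSpace Ω] {P : Measure Ω} {ι : ℕ → Type*} [∀ n, Fintype (ι n)]
  [∀ n, DecidableEq (ι n)] {p : ℕ → ℕ} {γ t : ℝ} {ν : ∀ n, Fin (p n) → Measure (ι n → ℝ)}
  [∀ n j, IsProbabilityMeasure (ν n j)] {z : ∀ n, Ω → Fin (p n) → ι n → ℝ}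

theorem ae_tendsto_resolventTrace_sub_integral (ht : 0 < t) (hγ : 0 < γ)
    (hcard : ∀ᶠ n : ℕ in atTop, n ≤ Fintype.card (ι n))
    (hratio : Tendsto (fun n => (Fintype.card (ι n) : ℝ) / p n) atTop (𝓝 γ))
    (hz : ∀ n, HasLaw (z n) (Measure.pi (ν n)) P) :
    ∀ᵐ ω ∂P, Tendsto (fun n => resolventTrace t (z n ω) -
      ∫ y, resolventTrace t y ∂Measure.pi (ν n)) atTop (𝓝 0) := by
  have := (hz 0).isProbabilityMeasure
  refine ae_tendsto_zero_of_summable_measureReal fun ε hε => ?_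
  have hsum : Summable fun n : ℕ => 2 * Real.exp (n * -(ε ^ 2 * t ^ 2 / 2 * (γ / 2))) :=
    (Real.summable_exp_nat_mul_iff.2 (neg_neg_of_pos (by positivity))).mul_left 2
  refine Summable.of_norm_bounded_eventually_nat hsum ?_
  filter_upwards [hcard, hratio.eventually_const_le (half_lt_self hγ)] with n hn hn'
  rw [Real.norm_of_nonneg measureReal_nonneg, (hz n).measureReal_eq
    (p := fun y => ε ≤ |resolventTrace t y - ∫ y, resolventTrace t y ∂Measure.pi (ν n)|)
    (measurableSet_le measurable_const
      ((continuous_resolventTrace ht).measurable.sub_const _).abs)]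
  refine (measureReal_abs_resolventTrace_sub_integral_ge_le (ν n) ht hε.le).trans ?_
  have hn_le : (n : ℝ) ≤ Fintype.card (ι n) := Nat.cast_le.2 hn
  rw [mul_neg, mul_comm (n : ℝ)]
  gcongr

theorem tendsto_integral_abs_resolventTrace_sub_integral (ht : 0 < t) (hγ : 0 < γ)
    (hcard : ∀ᶠ n : ℕ in atTop, n ≤ Fintype.card (ι n))
    (hratio : Tendsto (fun n => (Fintype.card (ι n) : ℝ) / p n) atTop (𝓝 γ))
    (hz : ∀ n, HasLaw (z n) (Measure.pi (ν n)) P) :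
    Tendsto (fun n => ∫ y, |resolventTrace t y - ∫ y, resolventTrace t y ∂Measure.pi (ν n)|
      ∂Measure.pi (ν n)) atTop (𝓝 0) := by
  have := (hz 0).isProbabilityMeasure
  have hmeas (n : ℕ) : Measurable fun y : Fin (p n) → ι n → ℝ =>
      |resolventTrace t y - ∫ y, resolventTrace t y ∂Measure.pi (ν n)| :=
    ((continuous_resolventTrace ht).measurable.sub_const _).abs
  simp only [← fun n => (hz n).integral_comp (hmeas n).aestronglyMeasurable]
  rw [← integral_zero Ω ℝ (μ := P)]
  refine tendsto_integral_of_dominated_convergence (fun _ => 1 / t + 1 / t)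
    (fun n => ((hmeas n).comp_aemeasurable (hz n).aemeasurable).aestronglyMeasurable)
    (integrable_const _) (fun n => ae_of_all _ fun ω => ?_) ?_
  · rw [Function.comp_apply, Real.norm_eq_abs, abs_abs]
    refine (abs_sub _ _).trans (add_le_add (abs_resolventTrace_le ht _) ?_)
    exact abs_integral_resolventTrace_le ht
  · filter_upwards [ae_tendsto_resolventTrace_sub_integral ht hγ hcard hratio hz] with ω hω
    simpa using hω.abs

theorem tendsto_integral_resolventTrace {δ : ℕ → ℝ} {m₀ : ℝ} (ht : 0 < t) (hγ : 0 < γ)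
    (hm₀ : 0 < m₀) (h₀ : γ * t * m₀ ^ 2 + (t + 1 - γ) * m₀ - 1 = 0)
    (hcard : ∀ᶠ n : ℕ in atTop, n ≤ Fintype.card (ι n))
    (hratio : Tendsto (fun n => (Fintype.card (ι n) : ℝ) / p n) atTop (𝓝 γ))
    (hz : ∀ n, HasLaw (z n) (Measure.pi (ν n)) P)
    (hvar : ∀ n j, QuadFormVarianceLE (ν n j) (δ n)) (hδ : Tendsto δ atTop (𝓝 0)) :
    Tendsto (fun n => ∫ y, resolventTrace t y ∂Measure.pi (ν n)) atTop (𝓝 m₀) := by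
  have hcard_atTop : Tendsto (fun n => (Fintype.card (ι n) : ℝ)) atTop atTop :=
    tendsto_natCast_atTop_atTop.comp (tendsto_atTop_mono' _ hcard tendsto_id)
  have hp : ∀ᶠ n in atTop, p n ≠ 0 := by
    filter_upwards [hratio.eventually_const_lt hγ] with n hn h
    simp [h] at hn
  have hinv : Tendsto (fun n => 1 / t / (p n : ℝ)) atTop (𝓝 0) := by
    have hprod := (hratio.mul hcard_atTop.inv_tendsto_atTop).const_mul (1 / t)
    rw [mul_zero, mul_zero] at hprod
    refine hprod.congr' ?_
    filter_upwards [hcard_atTop.eventually_gt_atTop 0] with n hn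
    rw [Pi.inv_apply]
    field_simp
  have herr := (((((hratio.pow 2).mul_const ((1 / t) ^ 2)).mul hδ).sqrt).add hinv).add
    (hratio.mul (tendsto_integral_abs_resolventTrace_sub_integral ht hγ hcard hratio hz))
  simp only [mul_zero, Real.sqrt_zero, add_zero] at herr
  refine tendsto_of_selfConsistent hγ ht hm₀ h₀ hratio (b := 1 / t) (fun n =>
    ⟨integral_nonneg fun y => resolventTrace_nonneg ht y,
      (le_abs_self _).trans (abs_integral_resolventTrace_le ht)⟩) ?_
  refine squeeze_zero_norm' ?_ herr
  filter_upwards [hp, hcard_atTop.eventually_gt_atTop 0] with n hpn hn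
  have : Nonempty (ι n) := Fintype.card_pos_iff.1 (Nat.cast_pos.1 hn)
  exact abs_selfConsistent_le (hvar n) ht hpn rfl

theorem ae_tendsto_resolventTrace {δ : ℕ → ℝ} {m₀ : ℝ} (ht : 0 < t) (hγ : 0 < γ)
    (hm₀ : 0 < m₀) (h₀ : γ * t * m₀ ^ 2 + (t + 1 - γ) * m₀ - 1 = 0)
    (hcard : ∀ᶠ n : ℕ in atTop, n ≤ Fintype.card (ι n))
    (hratio : Tendsto (fun n => (Fintype.card (ι n) : ℝ) / p n) atTop (𝓝 γ))
    (hz : ∀ n, HasLaw (z n) (Measure.pi (ν n)) P)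
    (hvar : ∀ n j, QuadFormVarianceLE (ν n j) (δ n)) (hδ : Tendsto δ atTop (𝓝 0)) :
    ∀ᵐ ω ∂P, Tendsto (fun n => resolventTrace t (z n ω)) atTop (𝓝 m₀) := by
  filter_upwards [ae_tendsto_resolventTrace_sub_integral ht hγ hcard hratio hz] with ω hω
  simpa using hω.add
    (tendsto_integral_resolventTrace ht hγ hm₀ h₀ hcard hratio hz hvar hδ)

end ResolventConvergence

section StieltjesContinuity

open unitInterval

theorem stieltjesKernel_den_pos (t : Set.Ioi (0 : ℝ)) (y : I) : 0 < (1 - (y : ℝ)) + t * y := by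
  rcases y.2.1.eq_or_lt with hy | hy
  · simp [← hy]
  · exact add_pos_of_nonneg_of_pos (sub_nonneg.2 y.2.2) (mul_pos t.2 hy)

/-- The functions `x ↦ 1 / (x + t)` on `[0, ∞]`, written in the coordinate `y = 1 / (1 + x)` of the
compact space `I`. Their integrals are the values of the Stieltjes transform on the negative
half-line. -/
def stieltjesKernel : C(Set.Ioi (0 : ℝ), C(I, ℝ)) :=
  ContinuousMap.curry ⟨fun q => (q.2 : ℝ) / ((1 - q.2) + q.1 * q.2),
    Continuous.div (by fun_prop) (by fun_prop) fun q => (stieltjesKernel_den_pos q.1 q.2).ne'⟩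

theorem stieltjesKernel_apply (t : Set.Ioi (0 : ℝ)) (y : I) :
    stieltjesKernel t y = (y : ℝ) / ((1 - y) + t * y) := rfl

/-- The resolvent identity for scalars. -/
theorem stieltjesKernel_mul {s t : Set.Ioi (0 : ℝ)} (h : (s : ℝ) ≠ t) :
    stieltjesKernel s * stieltjesKernel t =
      ((s : ℝ) - t)⁻¹ • (stieltjesKernel t - stieltjesKernel s) := by
  ext y
  have hs := (stieltjesKernel_den_pos s y).ne'
  have ht := (stieltjesKernel_den_pos t y).ne'
  have hst := sub_ne_zero.2 h
  simp only [ContinuousMap.mul_apply, ContinuousMap.smul_apply, ContinuousMap.sub_apply,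
    stieltjesKernel_apply, smul_eq_mul]
  rw [div_mul_div_comm, div_sub_div _ _ ht hs, inv_mul_eq_div, div_div,
    div_eq_div_iff (mul_ne_zero hs ht) (mul_ne_zero (mul_ne_zero ht hs) hst)]
  ring

/-- The closed linear span of the functions `x ↦ 1 / (x + t)`. It is closed under multiplication,
so that the Weierstrass theorem applies to it. -/
def stieltjesSpan : Submodule ℝ C(I, ℝ) :=
  (Submodule.span ℝ (Set.range stieltjesKernel)).topologicalClosure

theorem stieltjesKernel_mem_stieltjesSpan (t : Set.Ioi (0 : ℝ)) :
    stieltjesKernel t ∈ stieltjesSpan :=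
  Submodule.le_topologicalClosure _ (Submodule.subset_span ⟨t, rfl⟩)

theorem stieltjesKernel_mul_stieltjesKernel_mem (s t : Set.Ioi (0 : ℝ)) :
    stieltjesKernel s * stieltjesKernel t ∈ stieltjesSpan := by
  have hclosed : IsClosed {t | stieltjesKernel s * stieltjesKernel t ∈ stieltjesSpan} :=
    (Submodule.isClosed_topologicalClosure _).preimage
      (continuous_const.mul stieltjesKernel.continuous)
  refine hclosed.closure_subset_iff.2 (fun t ht => ?_) (dense_compl_singleton s t)
  rw [Set.mem_ofPred_eq, stieltjesKernel_mul (Subtype.coe_ne_coe.2 (Ne.symm ht))]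
  exact stieltjesSpan.smul_mem _ (stieltjesSpan.sub_mem (stieltjesKernel_mem_stieltjesSpan t)
    (stieltjesKernel_mem_stieltjesSpan s))

theorem stieltjesKernel_mul_mem (s : Set.Ioi (0 : ℝ)) {g : C(I, ℝ)} (hg : g ∈ stieltjesSpan) :
    stieltjesKernel s * g ∈ stieltjesSpan := by
  have hspan : Submodule.span ℝ (Set.range stieltjesKernel) ≤
      stieltjesSpan.comap (LinearMap.mulLeft ℝ (stieltjesKernel s)) :=
    Submodule.span_le.2 (Set.range_subset_iff.2 (stieltjesKernel_mul_stieltjesKernel_mem s))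
  have hclosed : IsClosed {g | stieltjesKernel s * g ∈ stieltjesSpan} :=
    (Submodule.isClosed_topologicalClosure _).preimage (continuous_const.mul continuous_id)
  exact hclosed.closure_subset_iff.2 hspan hg

theorem stieltjesKernel_pow_succ_mem (s : Set.Ioi (0 : ℝ)) (k : ℕ) :
    stieltjesKernel s ^ (k + 1) ∈ stieltjesSpan := by
  induction k with
  | zero => simpa only [zero_add, pow_one] using stieltjesKernel_mem_stieltjesSpan s
  | succ k ih => simpa only [pow_succ' _ (k + 1)] using stieltjesKernel_mul_mem s ih

/-- The kernel at `t = 1` is the coordinate function `y`. -/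
theorem polynomialFunctions_eq_adjoin_stieltjesKernel :
    polynomialFunctions I =
      Algebra.adjoin ℝ {stieltjesKernel ⟨1, Set.mem_Ioi.2 one_pos⟩} := by
  rw [polynomialFunctions.eq_adjoin_X]
  congr 2
  ext y
  simp [stieltjesKernel_apply]

theorem eq_top_of_stieltjesKernel_mem {W : Submodule ℝ C(I, ℝ)} (hW : IsClosed (W : Set C(I, ℝ)))
    (hone : 1 ∈ W) {D : Set (Set.Ioi (0 : ℝ))} (hD : Dense D)
    (hDW : ∀ t ∈ D, stieltjesKernel t ∈ W) : W = ⊤ := by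
  have hkernel (t : Set.Ioi (0 : ℝ)) : stieltjesKernel t ∈ W :=
    (hW.preimage stieltjesKernel.continuous).closure_subset_iff.2 hDW (hD t)
  have hspan : stieltjesSpan ≤ W :=
    Submodule.topologicalClosure_minimal _
      (Submodule.span_le.2 (Set.range_subset_iff.2 hkernel)) hW
  have hpoly : (polynomialFunctions I).toSubmodule ≤ W := by
    rw [polynomialFunctions_eq_adjoin_stieltjesKernel, Algebra.adjoin_eq_span, Submodule.span_le]
    intro f hf
    obtain ⟨k, rfl⟩ := Submonoid.mem_closure_singleton.1 hf
    cases k with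
    | zero => exact hone
    | succ k => exact hspan (stieltjesKernel_pow_succ_mem _ k)
  have hdense : Dense (polynomialFunctions I : Set C(I, ℝ)) := fun f => by
    rw [← Subalgebra.topologicalClosure_coe, polynomialFunctions_closure_eq_top']
    trivial
  exact eq_top_iff.2 fun f _ => hW.closure_subset_iff.2 hpoly (hdense f)

theorem integrable_continuousMap (ρ : Measure I) [IsFiniteMeasure ρ] (f : C(I, ℝ)) :
    Integrable f ρ :=
  f.continuous.integrable_of_hasCompactSupport (HasCompactSupport.of_compactSpace f)

theorem lipschitzWith_one_integral_continuousMap (ρ : Measure I) [IsProbabilityMeasure ρ] :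
    LipschitzWith 1 fun f : C(I, ℝ) => ∫ y, f y ∂ρ := by
  refine LipschitzWith.mk_one fun f g => ?_
  rw [dist_eq_norm, ← integral_sub (integrable_continuousMap ρ f) (integrable_continuousMap ρ g)]
  simpa using norm_integral_le_of_norm_le_const (μ := ρ) (C := dist f g)
    (ae_of_all _ fun y => (dist_eq_norm (f y) (g y)).symm.trans_le (f.dist_apply_le_dist y))

theorem tendsto_integral_of_tendsto_integral_stieltjesKernel {κ : Type*} {l : Filter κ}
    {ρ : κ → Measure I} [∀ n, IsProbabilityMeasure (ρ n)] {ρ₀ : Measure I}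
    [IsProbabilityMeasure ρ₀] {D : Set (Set.Ioi (0 : ℝ))} (hD : Dense D)
    (h : ∀ t ∈ D, Tendsto (fun n => ∫ y, stieltjesKernel t y ∂ρ n) l
      (𝓝 (∫ y, stieltjesKernel t y ∂ρ₀))) (f : C(I, ℝ)) :
    Tendsto (fun n => ∫ y, f y ∂ρ n) l (𝓝 (∫ y, f y ∂ρ₀)) := by
  let W : Submodule ℝ C(I, ℝ) :=
    { carrier := {f | Tendsto (fun n => ∫ y, f y ∂ρ n) l (𝓝 (∫ y, f y ∂ρ₀))}
      add_mem' := fun {f g} hf hg => by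
        simpa only [Set.mem_ofPred_eq, ContinuousMap.add_apply, integral_add
          (integrable_continuousMap _ f) (integrable_continuousMap _ g)] using Tendsto.add hf hg
      zero_mem' := by simp [tendsto_const_nhds]
      smul_mem' := fun c f hf => by
        simpa only [Set.mem_ofPred_eq, ContinuousMap.smul_apply, smul_eq_mul, integral_const_mul]
          using Tendsto.const_mul c hf }
  have hW : IsClosed (W : Set C(I, ℝ)) :=
    (LipschitzWith.uniformEquicontinuous _ 1 fun n =>
      lipschitzWith_one_integral_continuousMap (ρ n)).equicontinuous.isClosed_setOfPred_tendsto
        (lipschitzWith_one_integral_continuousMap ρ₀).continuous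
  have htop := eq_top_of_stieltjesKernel_mem hW (by simp [W, tendsto_const_nhds]) hD h
  exact (htop ▸ Submodule.mem_top : f ∈ W)

/-- The homeomorphism `x ↦ 1 / (1 + x)` of `[0, ∞)` onto `(0, 1]`, extended to `ℝ` by symmetry. -/
def toUnit (x : ℝ) : I :=
  ⟨1 / (1 + |x|), by positivity, div_le_one_of_le₀ (by linarith [abs_nonneg x]) (by positivity)⟩

theorem continuous_toUnit : Continuous toUnit := by
  unfold toUnit
  exact (Continuous.div (by fun_prop) (by fun_prop) fun x => by positivity).subtype_mk _

theorem coe_toUnit_of_nonneg {x : ℝ} (hx : 0 ≤ x) : (toUnit x : ℝ) = 1 / (1 + x) :=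
  congrArg (fun y => 1 / (1 + y)) (abs_of_nonneg hx)

theorem stieltjesKernel_toUnit {x : ℝ} (hx : 0 ≤ x) (t : Set.Ioi (0 : ℝ)) :
    stieltjesKernel t (toUnit x) = 1 / (x + t) := by
  have : (0 : ℝ) < t := t.2
  have hden : 1 - 1 / (1 + x) + t * (1 / (1 + x)) = (x + t) / (1 + x) := by
    field_simp
    ring
  rw [stieltjesKernel_apply, coe_toUnit_of_nonneg hx, hden, div_div_div_cancel_right₀]
  positivity

theorem toUnit_le_toUnit_iff {x y : ℝ} (hx : 0 ≤ x) (hy : 0 ≤ y) :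
    toUnit x ≤ toUnit y ↔ y ≤ x := by
  rw [← Subtype.coe_le_coe, coe_toUnit_of_nonneg hx, coe_toUnit_of_nonneg hy,
    one_div_le_one_div (by positivity) (by positivity), add_le_add_iff_left]

theorem toUnit_eq_toUnit_iff {x y : ℝ} (hx : 0 ≤ x) (hy : 0 ≤ y) :
    toUnit x = toUnit y ↔ x = y := by
  rw [le_antisymm_iff, toUnit_le_toUnit_iff hx hy, toUnit_le_toUnit_iff hy hx, le_antisymm_iff,
    and_comm]

section MapToUnit

variable {ν : Measure ℝ} {x : ℝ}

theorem ae_nonneg_of_measure_Iio_zero (hν : ν (Set.Iio 0) = 0) : ∀ᵐ y ∂ν, 0 ≤ y :=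
  (measure_eq_zero_iff_ae_notMem.1 hν).mono fun _ hy => not_lt.1 hy

theorem integral_stieltjesKernel_map_toUnit (hν : ν (Set.Iio 0) = 0) (t : Set.Ioi (0 : ℝ)) :
    ∫ y, stieltjesKernel t y ∂ν.map toUnit = ∫ y, 1 / (y + (t : ℝ)) ∂ν := by
  rw [integral_map continuous_toUnit.aemeasurable
    (stieltjesKernel t).continuous.aestronglyMeasurable]
  refine integral_congr_ae ?_
  filter_upwards [ae_nonneg_of_measure_Iio_zero hν] with y hy
  exact stieltjesKernel_toUnit hy t

theorem map_toUnit_Ici (hν : ν (Set.Iio 0) = 0) (hx : 0 ≤ x) :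
    ν.map toUnit (Set.Ici (toUnit x)) = ν (Set.Iic x) := by
  rw [Measure.map_apply continuous_toUnit.measurable measurableSet_Ici]
  refine measure_congr ?_
  filter_upwards [ae_nonneg_of_measure_Iio_zero hν] with y hy
  exact propext (toUnit_le_toUnit_iff hx hy)

theorem map_toUnit_singleton (hν : ν (Set.Iio 0) = 0) (hx : 0 ≤ x) :
    ν.map toUnit {toUnit x} = ν {x} := by
  rw [Measure.map_apply continuous_toUnit.measurable (measurableSet_singleton _)]
  refine measure_congr ?_
  filter_upwards [ae_nonneg_of_measure_Iio_zero hν] with y hy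
  exact propext (toUnit_eq_toUnit_iff hy hx)

instance isProbabilityMeasure_map_toUnit [IsProbabilityMeasure ν] :
    IsProbabilityMeasure (ν.map toUnit) :=
  Measure.isProbabilityMeasure_map continuous_toUnit.aemeasurable

theorem measureReal_Iic_of_neg (hν : ν (Set.Iio 0) = 0) (hx : x < 0) :
    ν.real (Set.Iic x) = 0 := by
  rw [measureReal_def, measure_mono_null (Set.Iic_subset_Iio.2 hx) hν, ENNReal.toReal_zero]

end MapToUnit

theorem tendsto_measureReal_Iic_of_tendsto_integral {κ : Type*} {l : Filter κ}
    {ν : κ → Measure ℝ} [∀ n, IsProbabilityMeasure (ν n)] {ν₀ : Measure ℝ}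
    [IsProbabilityMeasure ν₀] (hν : ∀ n, ν n (Set.Iio 0) = 0) (hν₀ : ν₀ (Set.Iio 0) = 0)
    {D : Set (Set.Ioi (0 : ℝ))} (hD : Dense D)
    (h : ∀ t ∈ D, Tendsto (fun n => ∫ x, 1 / (x + (t : ℝ)) ∂ν n) l
      (𝓝 (∫ x, 1 / (x + (t : ℝ)) ∂ν₀))) {x : ℝ} (hx : ν₀ {x} = 0) :
    Tendsto (fun n => (ν n).real (Set.Iic x)) l (𝓝 (ν₀.real (Set.Iic x))) := by
  rcases lt_or_ge x 0 with hneg | hnonneg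
  · simp only [measureReal_Iic_of_neg (hν _) hneg, measureReal_Iic_of_neg hν₀ hneg,
      tendsto_const_nhds]
  let ρ (n : κ) : ProbabilityMeasure I := ⟨(ν n).map toUnit, inferInstance⟩
  let ρ₀ : ProbabilityMeasure I := ⟨ν₀.map toUnit, inferInstance⟩
  have hρ : Tendsto ρ l (𝓝 ρ₀) := by
    refine ProbabilityMeasure.tendsto_iff_forall_integral_tendsto.2 fun f =>
      tendsto_integral_of_tendsto_integral_stieltjesKernel (ρ := fun n => (ν n).map toUnit)
        (ρ₀ := ν₀.map toUnit) hD (fun t ht => ?_) f.toContinuousMap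
    simpa only [integral_stieltjesKernel_map_toUnit (hν _),
      integral_stieltjesKernel_map_toUnit hν₀] using h t ht
  have hfrontier : (ρ₀ : Measure I) (frontier (Set.Ici (toUnit x))) = 0 :=
    measure_mono_null (frontier_Ici_subset _) ((map_toUnit_singleton hν₀ hnonneg).trans hx)
  have hIci := (ENNReal.tendsto_toReal (measure_ne_top _ _)).comp
    (ProbabilityMeasure.tendsto_measure_of_null_frontier_of_tendsto' hρ hfrontier)
  simpa only [ρ, ρ₀, measureReal_def, Function.comp_def, ProbabilityMeasure.coe_mk,
    map_toUnit_Ici (hν _) hnonneg, map_toUnit_Ici hν₀ hnonneg] using hIci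

end StieltjesContinuity

section MarchenkoPastur

section Semicircle

variable {r c u : ℝ}

theorem hasDerivAt_sqrt_sq_sub_sq (hu : u ∈ Set.Ioo (-r) r) :
    HasDerivAt (fun u => √(r ^ 2 - u ^ 2)) (-u / √(r ^ 2 - u ^ 2)) u := by
  have hpos : 0 < r ^ 2 - u ^ 2 := sub_pos.2 (sq_lt_sq' hu.1 hu.2)
  refine (((hasDerivAt_pow 2 u).const_sub (r ^ 2)).sqrt hpos.ne').congr_deriv ?_
  field_simp
  norm_num

theorem hasDerivAt_arcsin_div (hr : 0 < r) (hu : u ∈ Set.Ioo (-r) r) :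
    HasDerivAt (fun u => Real.arcsin (u / r)) (1 / √(r ^ 2 - u ^ 2)) u := by
  have hneg : -1 < u / r := by rw [lt_div_iff₀ hr]; linarith [hu.1]
  have hlt : u / r < 1 := by rw [div_lt_iff₀ hr]; linarith [hu.2]
  refine ((Real.hasDerivAt_arcsin hneg.ne' hlt.ne).comp u
    ((hasDerivAt_id' u).div_const r)).congr_deriv ?_
  have hsq : 1 - (u / r) ^ 2 = (r ^ 2 - u ^ 2) / r ^ 2 := by field_simp
  rw [hsq, Real.sqrt_div' _ (sq_nonneg r), Real.sqrt_sq hr.le]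
  field_simp

theorem hasDerivAt_div_mul_add (hr : r ≠ 0) (hcu : c + u ≠ 0) :
    HasDerivAt (fun u => (r ^ 2 + c * u) / (r * (c + u)))
      ((c ^ 2 - r ^ 2) / (r * (c + u) ^ 2)) u := by
  have hnum := ((hasDerivAt_id' u).const_mul c).const_add (r ^ 2)
  have hden := ((hasDerivAt_id' u).const_add c).const_mul r
  refine (hnum.fun_div hden (mul_ne_zero hr hcu)).congr_deriv ?_
  rw [div_eq_div_iff (by positivity) (by positivity)]
  ring

theorem hasDerivAt_sqrt_mul_arcsin (hr : 0 < r) (hc : r ≤ c) (hu : u ∈ Set.Ioo (-r) r) :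
    HasDerivAt (fun u => √(c ^ 2 - r ^ 2) * Real.arcsin ((r ^ 2 + c * u) / (r * (c + u))))
      ((c ^ 2 - r ^ 2) / (√(r ^ 2 - u ^ 2) * (c + u))) u := by
  rcases hc.eq_or_lt with rfl | hrc
  · simpa using hasDerivAt_const u (0 : ℝ)
  have hcu : 0 < c + u := by linarith [hu.1]
  have hu_pos : 0 < r ^ 2 - u ^ 2 := sub_pos.2 (sq_lt_sq' hu.1 hu.2)
  have hc_pos : 0 < c ^ 2 - r ^ 2 := sub_pos.2 (pow_lt_pow_left₀ hrc hr.le two_ne_zero)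
  have := Real.sqrt_pos.2 hu_pos
  have := Real.sqrt_pos.2 hc_pos
  set w := (r ^ 2 + c * u) / (r * (c + u)) with hw
  have hw_sq : 1 - w ^ 2 = (c ^ 2 - r ^ 2) * (r ^ 2 - u ^ 2) / (r * (c + u)) ^ 2 := by
    rw [hw]
    field_simp
    ring
  have hw_pos : 0 < 1 - w ^ 2 := by rw [hw_sq]; positivity
  refine (((Real.hasDerivAt_arcsin (x := w) (by nlinarith) (by nlinarith)).comp u
    (hasDerivAt_div_mul_add hr.ne' hcu.ne')).const_mul √(c ^ 2 - r ^ 2)).congr_deriv ?_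
  rw [hw_sq, Real.sqrt_div' _ (sq_nonneg _), Real.sqrt_sq (by positivity), Real.sqrt_mul hc_pos.le]
  field_simp

/-- An antiderivative of `√(r² - u²) / (c + u)` on `(-r, r)`, for `0 < r ≤ c`. -/
def semicircleAntideriv (r c u : ℝ) : ℝ :=
  √(r ^ 2 - u ^ 2) + c * Real.arcsin (u / r) -
    √(c ^ 2 - r ^ 2) * Real.arcsin ((r ^ 2 + c * u) / (r * (c + u)))

theorem hasDerivAt_semicircleAntideriv (hr : 0 < r) (hc : r ≤ c) (hu : u ∈ Set.Ioo (-r) r) :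
    HasDerivAt (semicircleAntideriv r c) (√(r ^ 2 - u ^ 2) / (c + u)) u := by
  have hcu : 0 < c + u := by linarith [hu.1]
  have hpos : 0 < r ^ 2 - u ^ 2 := sub_pos.2 (sq_lt_sq' hu.1 hu.2)
  have := Real.sqrt_pos.2 hpos
  refine (((hasDerivAt_sqrt_sq_sub_sq hu).add ((hasDerivAt_arcsin_div hr hu).const_mul c)).sub
    (hasDerivAt_sqrt_mul_arcsin hr hc hu)).congr_deriv ?_
  field_simp
  linear_combination -Real.sq_sqrt hpos.le

theorem continuousOn_semicircleAntideriv (hr : 0 < r) (hc : r ≤ c) :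
    ContinuousOn (semicircleAntideriv r c) (Set.Icc (-r) r) := by
  unfold semicircleAntideriv
  rcases hc.eq_or_lt with rfl | hrc
  · simp only [sub_self, Real.sqrt_zero, zero_mul, sub_zero]
    fun_prop
  · refine ContinuousOn.sub (by fun_prop) (continuousOn_const.mul
      (Real.continuous_arcsin.comp_continuousOn
        (ContinuousOn.div (by fun_prop) (by fun_prop) fun u hu => ?_)))
    have : 0 < c + u := by linarith [hu.1]
    positivity

theorem semicircleAntideriv_right_sub_left (hr : 0 < r) (hc : r ≤ c) :
    semicircleAntideriv r c r - semicircleAntideriv r c (-r) =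
      Real.pi * (c - √(c ^ 2 - r ^ 2)) := by
  unfold semicircleAntideriv
  rw [neg_sq, sub_self, Real.sqrt_zero, neg_div, div_self hr.ne', Real.arcsin_neg,
    Real.arcsin_one]
  rcases hc.eq_or_lt with rfl | hrc
  · simp only [sub_self, Real.sqrt_zero, zero_mul]
    ring
  · have hright : (r ^ 2 + c * r) / (r * (c + r)) = 1 := by
      have : 0 < c + r := by linarith
      rw [div_eq_one_iff_eq (by positivity)]
      ring
    have hleft : (r ^ 2 + c * -r) / (r * (c + -r)) = -1 := by
      rw [div_eq_iff (mul_ne_zero hr.ne' (by linarith))]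
      ring
    rw [hright, hleft, Real.arcsin_neg, Real.arcsin_one]
    ring

theorem intervalIntegrable_sqrt_div (hr : 0 < r) (hc : r ≤ c) :
    IntervalIntegrable (fun u => √(r ^ 2 - u ^ 2) / (c + u)) volume (-r) r :=
  (intervalIntegrable_iff_integrableOn_Ioc_of_le (by linarith)).2 <|
    intervalIntegral.integrableOn_deriv_of_nonneg (continuousOn_semicircleAntideriv hr hc)
      (fun _ hu => hasDerivAt_semicircleAntideriv hr hc hu)
      (fun u hu => div_nonneg (Real.sqrt_nonneg _) (by linarith [hu.1]))

theorem integral_sqrt_div (hr : 0 < r) (hc : r ≤ c) :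
    ∫ u in (-r)..r, √(r ^ 2 - u ^ 2) / (c + u) = Real.pi * (c - √(c ^ 2 - r ^ 2)) := by
  rw [intervalIntegral.integral_eq_sub_of_hasDerivAt_of_le (by linarith)
    (continuousOn_semicircleAntideriv hr hc)
    (fun _ hu => hasDerivAt_semicircleAntideriv hr hc hu) (intervalIntegrable_sqrt_div hr hc),
    semicircleAntideriv_right_sub_left hr hc]

end Semicircle

variable {γ t : ℝ}

theorem one_add_sqrt_sq (hγ : 0 ≤ γ) : (1 + √γ) ^ 2 = 2 * √γ + (1 + γ) := by
  linear_combination Real.sq_sqrt hγ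

theorem one_sub_sqrt_sq (hγ : 0 ≤ γ) : (1 - √γ) ^ 2 = -(2 * √γ) + (1 + γ) := by
  linear_combination Real.sq_sqrt hγ

theorem two_mul_sqrt_le_one_add (hγ : 0 ≤ γ) : 2 * √γ ≤ 1 + γ := by
  linarith [sq_nonneg (1 - √γ), one_sub_sqrt_sq hγ]

/-- The function `√((b - y)(y - a)) / (y + t)` on the support `[a, b]` of the Marchenko–Pastur
density, written in terms of the distance of `y` to the midpoint `1 + γ`. For `t = 0` it is
proportional to the density, for `t > 0` it enters its Stieltjes transform. -/
def mpKernel (γ t : ℝ) : ℝ → ℝ :=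
  (Set.Icc ((1 - √γ) ^ 2) ((1 + √γ) ^ 2)).indicator
    fun y => √((2 * √γ) ^ 2 - (y - (1 + γ)) ^ 2) / (1 + γ + t + (y - (1 + γ)))

theorem integrable_mpKernel (hγ : 0 < γ) (ht : 0 ≤ t) : Integrable (mpKernel γ t) := by
  have hr : 0 < 2 * √γ := by positivity
  have h := (intervalIntegrable_sqrt_div hr
    (c := 1 + γ + t) (by linarith [two_mul_sqrt_le_one_add hγ.le])).comp_sub_right (1 + γ)
  rw [← one_add_sqrt_sq hγ.le, ← one_sub_sqrt_sq hγ.le,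
    intervalIntegrable_iff_integrableOn_Icc_of_le
      (by rw [one_add_sqrt_sq hγ.le, one_sub_sqrt_sq hγ.le]; linarith)] at h
  exact h.integrable_indicator measurableSet_Icc

theorem integral_mpKernel (hγ : 0 < γ) (ht : 0 ≤ t) :
    ∫ y, mpKernel γ t y = Real.pi * (1 + γ + t - √((1 + γ + t) ^ 2 - 4 * γ)) := by
  have hr : 0 < 2 * √γ := by positivity
  have hsq : (2 * √γ) ^ 2 = 4 * γ := by
    rw [mul_pow, Real.sq_sqrt hγ.le]
    norm_num
  rw [mpKernel, integral_indicator measurableSet_Icc, integral_Icc_eq_integral_Ioc,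
    one_add_sqrt_sq hγ.le, one_sub_sqrt_sq hγ.le,
    ← intervalIntegral.integral_of_le (by linarith),
    intervalIntegral.integral_comp_sub_right
      (fun u => √((2 * √γ) ^ 2 - u ^ 2) / (1 + γ + t + u)) (1 + γ), add_sub_cancel_right,
    add_sub_cancel_right, integral_sqrt_div hr (by linarith [two_mul_sqrt_le_one_add hγ.le]), hsq]

theorem mpDensity_eq_mpKernel (hγ : 0 < γ) (y : ℝ) :
    mpDensity γ y = 1 / (2 * Real.pi * γ) * mpKernel γ 0 y := by
  rw [mpDensity, mpKernel, ← smul_eq_mul (1 / _), ← Set.indicator_const_smul_apply]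
  refine congrArg (fun f => Set.indicator _ f y) (funext fun y => ?_)
  rw [smul_eq_mul, one_div_mul_eq_div, div_div, add_zero, add_sub_cancel, mul_comm y]
  congr 2
  linear_combination (2 * y - √γ ^ 2 - γ - 2) * Real.sq_sqrt hγ.le

theorem mpDensity_nonneg (hγ : 0 ≤ γ) (y : ℝ) : 0 ≤ mpDensity γ y := by
  refine Set.indicator_nonneg (fun y hy => ?_) y
  have : 0 ≤ y := (sq_nonneg _).trans hy.1
  positivity

theorem mpDensity_of_neg {y : ℝ} (hy : y < 0) : mpDensity γ y = 0 :=
  Set.indicator_of_notMem (fun h => not_lt.2 ((sq_nonneg _).trans h.1) hy) _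

theorem mpKernel_apply_zero (hγ : 0 ≤ γ) : mpKernel γ t 0 = 0 := by
  refine Set.indicator_apply_eq_zero.2 fun _ => ?_
  have hneg : (2 * √γ) ^ 2 - (0 - (1 + γ)) ^ 2 ≤ 0 := by
    rw [mul_pow, Real.sq_sqrt hγ]
    linarith [sq_nonneg (1 - γ)]
  rw [Real.sqrt_eq_zero_of_nonpos hneg, zero_div]

theorem mpKernel_zero_mul_one_div (hγ : 0 ≤ γ) (ht : 0 < t) (y : ℝ) :
    mpKernel γ 0 y * (1 / (y + t)) = 1 / t * (mpKernel γ 0 y - mpKernel γ t y) := by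
  rcases eq_or_ne y 0 with rfl | hy
  · simp only [mpKernel_apply_zero hγ, zero_mul, sub_self, mul_zero]
  by_cases hmem : y ∈ Set.Icc ((1 - √γ) ^ 2) ((1 + √γ) ^ 2)
  · have hy_pos : 0 < y := lt_of_le_of_ne ((sq_nonneg _).trans hmem.1) hy.symm
    have hshift : 1 + γ + t + (y - (1 + γ)) = y + t := by ring
    rw [mpKernel, mpKernel, Set.indicator_of_mem hmem, Set.indicator_of_mem hmem, add_zero,
      add_sub_cancel, hshift]
    field_simp
    ring
  · rw [mpKernel, mpKernel, Set.indicator_of_notMem hmem, Set.indicator_of_notMem hmem, zero_mul,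
      sub_self, mul_zero]

theorem integrable_mpDensity (hγ : 0 < γ) : Integrable (mpDensity γ) := by
  rw [funext (mpDensity_eq_mpKernel hγ)]
  exact (integrable_mpKernel hγ le_rfl).const_mul _

theorem sqrt_one_add_sq_sub_four_mul : √((1 + γ + 0) ^ 2 - 4 * γ) = |γ - 1| := by
  rw [← Real.sqrt_sq_eq_abs]
  ring_nf

theorem integral_mpDensity (hγ : 0 < γ) :
    ∫ y, mpDensity γ y = (1 + γ - |γ - 1|) / (2 * γ) := by
  simp only [mpDensity_eq_mpKernel hγ]
  rw [integral_const_mul, integral_mpKernel hγ le_rfl, sqrt_one_add_sq_sub_four_mul, add_zero]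
  have := Real.pi_pos
  field_simp

theorem integrable_mpDensity_mul_one_div (hγ : 0 < γ) (ht : 0 < t) :
    Integrable fun y => mpDensity γ y * (1 / (y + t)) := by
  simp only [mpDensity_eq_mpKernel hγ, mul_assoc, mpKernel_zero_mul_one_div hγ.le ht]
  exact (((integrable_mpKernel hγ le_rfl).sub
    (integrable_mpKernel hγ ht.le)).const_mul _).const_mul _

theorem integral_mpDensity_mul_one_div (hγ : 0 < γ) (ht : 0 < t) :
    ∫ y, mpDensity γ y * (1 / (y + t)) =
      (√((1 + γ + t) ^ 2 - 4 * γ) - |γ - 1| - t) / (2 * γ * t) := by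
  simp only [mpDensity_eq_mpKernel hγ, mul_assoc, mpKernel_zero_mul_one_div hγ.le ht]
  rw [integral_const_mul, integral_const_mul, integral_sub (integrable_mpKernel hγ le_rfl)
    (integrable_mpKernel hγ ht.le), integral_mpKernel hγ le_rfl, integral_mpKernel hγ ht.le,
    sqrt_one_add_sq_sub_four_mul]
  have := Real.pi_pos
  field_simp
  ring

/-- The mass of the Marchenko–Pastur law at the origin. -/
def mpAtom (γ : ℝ) : ℝ := if 1 < γ then 1 - 1 / γ else 0

theorem mpAtom_eq_div (hγ : 0 < γ) : mpAtom γ = (γ - 1 + |γ - 1|) / (2 * γ) := by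
  unfold mpAtom
  split_ifs with h
  · rw [abs_of_pos (by linarith)]
    field_simp
    ring
  · rw [abs_of_nonpos (by linarith)]
    ring

theorem mpAtom_nonneg (hγ : 0 < γ) : 0 ≤ mpAtom γ := by
  rw [mpAtom_eq_div hγ]
  exact div_nonneg (by linarith [neg_abs_le (γ - 1)]) (by positivity)

/-- The Marchenko–Pastur law, as a measure with distribution function `mpCDF γ`. -/
def mpMeasure (γ : ℝ) : Measure ℝ :=
  ENNReal.ofReal (mpAtom γ) • Measure.dirac 0 +
    volume.withDensity fun y => ENNReal.ofReal (mpDensity γ y)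

theorem withDensity_mpDensity_apply (hγ : 0 < γ) {s : Set ℝ} (hs : MeasurableSet s) :
    volume.withDensity (fun y => ENNReal.ofReal (mpDensity γ y)) s =
      ENNReal.ofReal (∫ y in s, mpDensity γ y) := by
  rw [withDensity_apply _ hs, ofReal_integral_eq_lintegral_ofReal
    (integrable_mpDensity hγ).integrableOn (ae_of_all _ (mpDensity_nonneg hγ.le))]

theorem isProbabilityMeasure_mpMeasure (hγ : 0 < γ) : IsProbabilityMeasure (mpMeasure γ) := by
  refine ⟨?_⟩
  have hmass : mpAtom γ + ∫ y, mpDensity γ y = 1 := by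
    rw [mpAtom_eq_div hγ, integral_mpDensity hγ]
    field_simp
    ring
  rw [mpMeasure, Measure.add_apply, Measure.smul_apply, measure_univ, smul_eq_mul, mul_one,
    withDensity_mpDensity_apply hγ MeasurableSet.univ, setIntegral_univ,
    ← ENNReal.ofReal_add (mpAtom_nonneg hγ) (integral_nonneg (mpDensity_nonneg hγ.le)), hmass,
    ENNReal.ofReal_one]

theorem mpMeasure_real_Iic (hγ : 0 < γ) (x : ℝ) :
    (mpMeasure γ).real (Set.Iic x) = mpCDF γ x := by
  have hdirac : (Measure.dirac (0 : ℝ)).real (Set.Iic x) = if 0 ≤ x then 1 else 0 := by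
    rw [measureReal_def, Measure.dirac_apply' _ measurableSet_Iic]
    by_cases hx : 0 ≤ x <;> simp [hx]
  have hdensity : (volume.withDensity fun y => ENNReal.ofReal (mpDensity γ y)).real (Set.Iic x) =
      ∫ y in Set.Iic x, mpDensity γ y := by
    rw [measureReal_def, withDensity_mpDensity_apply hγ measurableSet_Iic,
      ENNReal.toReal_ofReal (integral_nonneg (mpDensity_nonneg hγ.le))]
  have hfin : volume.withDensity (fun y => ENNReal.ofReal (mpDensity γ y)) (Set.Iic x) ≠ ⊤ := by
    rw [withDensity_mpDensity_apply hγ measurableSet_Iic]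
    exact ENNReal.ofReal_ne_top
  have hatom : (ENNReal.ofReal (mpAtom γ) • Measure.dirac (0 : ℝ)) (Set.Iic x) ≠ ⊤ :=
    ENNReal.mul_ne_top ENNReal.ofReal_ne_top (measure_ne_top _ _)
  rw [mpMeasure, measureReal_add_apply hatom hfin, measureReal_ennreal_smul_apply,
    hdirac, hdensity, ENNReal.toReal_ofReal (mpAtom_nonneg hγ), mpCDF, ite_and, mpAtom, mul_ite,
    mul_one, mul_zero]

theorem mpMeasure_Iio_zero (hγ : 0 < γ) : mpMeasure γ (Set.Iio 0) = 0 := by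
  have hdensity : ∫ y in Set.Iio (0 : ℝ), mpDensity γ y = 0 :=
    setIntegral_eq_zero_of_forall_eq_zero fun _ hy => mpDensity_of_neg hy
  rw [mpMeasure, Measure.add_apply, Measure.smul_apply, Measure.dirac_apply' _ measurableSet_Iio,
    withDensity_mpDensity_apply hγ measurableSet_Iio, hdensity]
  simp

theorem mpMeasure_singleton_of_continuousAt (hγ : 0 < γ) {x : ℝ}
    (hx : ContinuousAt (mpCDF γ) x) : mpMeasure γ {x} = 0 := by
  have := isProbabilityMeasure_mpMeasure hγ
  have hcdf : ⇑(cdf (mpMeasure γ)) = mpCDF γ :=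
    funext fun y => (cdf_eq_real _ y).trans (mpMeasure_real_Iic hγ y)
  rw [← measure_cdf (mpMeasure γ), StieltjesFunction.measure_singleton, hcdf,
    leftLim_eq_of_tendsto (hx.tendsto.mono_left nhdsWithin_le_nhds), sub_self,
    ENNReal.ofReal_zero]

theorem integral_mpMeasure (hγ : 0 < γ) {f : ℝ → ℝ}
    (hf : Integrable fun y => mpDensity γ y * f y) :
    ∫ y, f y ∂mpMeasure γ = mpAtom γ * f 0 + ∫ y, mpDensity γ y * f y := by
  have hmeas : AEMeasurable fun y => ENNReal.ofReal (mpDensity γ y) :=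
    (integrable_mpDensity hγ).aemeasurable.ennreal_ofReal
  have htop : ∀ᵐ y : ℝ, ENNReal.ofReal (mpDensity γ y) < ⊤ :=
    ae_of_all _ fun _ => ENNReal.ofReal_lt_top
  have hdensity : Integrable f
      (volume.withDensity fun y => ENNReal.ofReal (mpDensity γ y)) := by
    rw [integrable_withDensity_iff_integrable_smul₀' hmeas htop]
    simpa only [ENNReal.toReal_ofReal (mpDensity_nonneg hγ.le _), smul_eq_mul] using hf
  have hdirac : Integrable f (ENNReal.ofReal (mpAtom γ) • Measure.dirac 0) :=
    (integrable_dirac (by simp)).smul_measure ENNReal.ofReal_ne_top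
  rw [mpMeasure, integral_add_measure hdirac hdensity, integral_smul_measure, integral_dirac,
    integral_withDensity_eq_integral_toReal_smul₀ hmeas htop]
  simp only [ENNReal.toReal_ofReal (mpDensity_nonneg hγ.le _),
    ENNReal.toReal_ofReal (mpAtom_nonneg hγ), smul_eq_mul]

theorem integral_one_div_add_mpMeasure (hγ : 0 < γ) (ht : 0 < t) :
    ∫ y, 1 / (y + t) ∂mpMeasure γ =
      (-(t + 1 - γ) + √((t + 1 - γ) ^ 2 + 4 * γ * t)) / (2 * (γ * t)) := by
  have hdisc : (1 + γ + t) ^ 2 - 4 * γ = (t + 1 - γ) ^ 2 + 4 * γ * t := by ring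
  rw [integral_mpMeasure hγ (integrable_mpDensity_mul_one_div hγ ht),
    integral_mpDensity_mul_one_div hγ ht, mpAtom_eq_div hγ, hdisc]
  field_simp
  ring

theorem integral_one_div_add_mpMeasure_pos (hγ : 0 < γ) (ht : 0 < t) :
    0 < ∫ y, 1 / (y + t) ∂mpMeasure γ := by
  have hlt : t + 1 - γ < √((t + 1 - γ) ^ 2 + 4 * γ * t) :=
    Real.lt_sqrt_of_sq_lt (lt_add_of_pos_right _ (by positivity))
  rw [integral_one_div_add_mpMeasure hγ ht]
  exact div_pos (by linarith) (by positivity)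

theorem integral_one_div_add_mpMeasure_selfConsistent (hγ : 0 < γ) (ht : 0 < t) :
    γ * t * (∫ y, 1 / (y + t) ∂mpMeasure γ) ^ 2 +
      (t + 1 - γ) * (∫ y, 1 / (y + t) ∂mpMeasure γ) - 1 = 0 := by
  have hdisc : discrim (γ * t) (t + 1 - γ) (-1) =
      √((t + 1 - γ) ^ 2 + 4 * γ * t) * √((t + 1 - γ) ^ 2 + 4 * γ * t) := by
    rw [discrim, Real.mul_self_sqrt (by positivity)]
    ring
  rw [sq, sub_eq_add_neg]
  exact (quadratic_eq_zero_iff (by positivity) hdisc _).2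
    (Or.inl (integral_one_div_add_mpMeasure hγ ht))

end MarchenkoPastur

section SpectralConvergence

section EmpiricalMeasure

variable {ι : Type*} [Fintype ι]

/-- The uniform distribution on a finite family of reals, counted with multiplicity. For the
eigenvalues of a symmetric matrix its distribution function is `esd`. -/
def empiricalMeasure (l : ι → ℝ) : Measure ℝ :=
  (Fintype.card ι : ENNReal)⁻¹ • ∑ i, Measure.dirac (l i)

instance isProbabilityMeasure_empiricalMeasure [Nonempty ι] (l : ι → ℝ) :
    IsProbabilityMeasure (empiricalMeasure l) where
  measure_univ := by
    simp only [empiricalMeasure, Measure.smul_apply, Measure.finsetSum_apply, measure_univ,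
      Finset.sum_const, Finset.card_univ, nsmul_eq_mul, mul_one, smul_eq_mul]
    exact ENNReal.inv_mul_cancel (by simp) (ENNReal.natCast_ne_top _)

theorem integral_empiricalMeasure (l : ι → ℝ) (f : ℝ → ℝ) :
    ∫ x, f x ∂empiricalMeasure l = (∑ i, f (l i)) / Fintype.card ι := by
  rw [empiricalMeasure, integral_smul_measure, integral_finsetSum_measure
    fun i _ => integrable_dirac (by simp), div_eq_inv_mul]
  simp only [integral_dirac, ENNReal.toReal_inv, ENNReal.toReal_natCast, smul_eq_mul]

theorem empiricalMeasure_Iio_zero {l : ι → ℝ} (hl : ∀ i, 0 ≤ l i) :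
    empiricalMeasure l (Set.Iio 0) = 0 := by
  have hdirac (i : ι) : Measure.dirac (l i) (Set.Iio (0 : ℝ)) = 0 := by
    rw [Measure.dirac_apply' _ measurableSet_Iio, Set.indicator_of_notMem (Set.notMem_Iio.2 (hl i))]
  simp only [empiricalMeasure, Measure.smul_apply, Measure.finsetSum_apply, hdirac,
    Finset.sum_const_zero, smul_zero]

theorem empiricalMeasure_eigenvalues_real_Iic [DecidableEq ι] {A : Matrix ι ι ℝ}
    (hA : A.IsHermitian) (x : ℝ) :
    (empiricalMeasure hA.eigenvalues).real (Set.Iic x) = esd hA x := by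
  have hind (y : ℝ) :
      (Set.Iic x).indicator (1 : ℝ → ℝ) y = (Set.Ici y).indicator (1 : ℝ → ℝ) x := rfl
  rw [← integral_indicator_one measurableSet_Iic, integral_empiricalMeasure, esd,
    ← one_div_mul_eq_div]
  simp only [hind]

end EmpiricalMeasure

theorem tendsto_esd_of_tendsto_resolventTrace {κ : Type*} {l : Filter κ} {ι : κ → Type*}
    [∀ k, Fintype (ι k)] [∀ k, DecidableEq (ι k)] [∀ k, Nonempty (ι k)] {p : κ → ℕ}
    {Z : ∀ k, Matrix (ι k) (Fin (p k)) ℝ} {γ : ℝ} (hγ : 0 < γ) {D : Set (Set.Ioi (0 : ℝ))}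
    (hD : Dense D) (h : ∀ t ∈ D, Tendsto (fun k => resolventTrace t (Z k).col) l
      (𝓝 (∫ y, 1 / (y + (t : ℝ)) ∂mpMeasure γ))) {x : ℝ} (hx : ContinuousAt (mpCDF γ) x) :
    Tendsto (fun k => esd (sampleCov_isHermitian (Z k)) x) l (𝓝 (mpCDF γ x)) := by
  have := isProbabilityMeasure_mpMeasure hγ
  simp only [← empiricalMeasure_eigenvalues_real_Iic, ← mpMeasure_real_Iic hγ]
  refine tendsto_measureReal_Iic_of_tendsto_integral
    (fun k => empiricalMeasure_Iio_zero (eigenvalues_sampleCov_nonneg (Z k)))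
    (mpMeasure_Iio_zero hγ) hD (fun t ht => ?_) (mpMeasure_singleton_of_continuousAt hγ hx)
  simpa only [integral_empiricalMeasure, resolventTrace_col_eq_sum t.2, add_comm (t : ℝ)]
    using h t ht

theorem ae_weaklyConverges_esd_mpCDF {Ω : Type*} [MeasurableSpace Ω] {P : Measure Ω}
    {ι : ℕ → Type*} [∀ n, Fintype (ι n)] [∀ n, DecidableEq (ι n)] {p : ℕ → ℕ}
    {ν : ∀ n, Fin (p n) → Measure (ι n → ℝ)} [∀ n j, IsProbabilityMeasure (ν n j)]
    {Z : ∀ n, Ω → Matrix (ι n) (Fin (p n)) ℝ} {γ : ℝ} {δ : ℕ → ℝ} (hγ : 0 < γ)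
    (hcard : ∀ᶠ n in atTop, n ≤ Fintype.card (ι n))
    (hratio : Tendsto (fun n => (Fintype.card (ι n) : ℝ) / p n) atTop (𝓝 γ))
    (hlaw : ∀ n, HasLaw (fun ω => (Z n ω).col) (Measure.pi (ν n)) P)
    (hvar : ∀ n j, QuadFormVarianceLE (ν n j) (δ n)) (hδ : Tendsto δ atTop (𝓝 0)) :
    ∀ᵐ ω ∂P, WeaklyConverges (fun n => esd (sampleCov_isHermitian (Z n ω))) (mpCDF γ) := by
  obtain ⟨D, hD_countable, hD⟩ := TopologicalSpace.exists_countable_dense (Set.Ioi (0 : ℝ))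
  have hresolvent := (ae_ball_iff hD_countable).2 fun t _ =>
    ae_tendsto_resolventTrace t.2 hγ (integral_one_div_add_mpMeasure_pos hγ t.2)
      (integral_one_div_add_mpMeasure_selfConsistent hγ t.2) hcard hratio hlaw hvar hδ
  obtain ⟨n₀, hn₀⟩ := eventually_atTop.1 (hcard.and (eventually_gt_atTop 0))
  have (n : ℕ) : Nonempty (ι (n + n₀)) :=
    have hn := hn₀ (n + n₀) le_add_self
    Fintype.card_pos_iff.1 (hn.2.trans_le hn.1)
  filter_upwards [hresolvent] with ω hω x hx
  refine (tendsto_add_atTop_iff_nat n₀).1 ?_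
  exact tendsto_esd_of_tendsto_resolventTrace hγ hD
    (fun t ht => (tendsto_add_atTop_iff_nat n₀).2 (hω t ht)) hx

end SpectralConvergence

section TensorIndex

theorem card_tensorIndex (n d : ℕ) : Fintype.card (TensorIndex n d) = n.choose d := by
  rw [Fintype.card_finset_len, Fintype.card_fin]

theorem descFactorial_mul_pow_le {n d : ℕ} (hdn : d ≤ n) (k : ℕ) :
    d.descFactorial k * n ^ k ≤ n.descFactorial k * d ^ k := by
  induction k with
  | zero => simp
  | succ k ih =>
    have hfactor : (d - k) * n ≤ (n - k) * d := by
      rw [Nat.sub_mul, Nat.sub_mul, mul_comm n d]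
      exact Nat.sub_le_sub_left (Nat.mul_le_mul_left k hdn) _
    rw [Nat.descFactorial_succ, Nat.descFactorial_succ, pow_succ, pow_succ]
    calc (d - k) * d.descFactorial k * (n ^ k * n)
        = (d - k) * n * (d.descFactorial k * n ^ k) := by ring
      _ ≤ (n - k) * d * (n.descFactorial k * d ^ k) := Nat.mul_le_mul hfactor ih
      _ = (n - k) * n.descFactorial k * (d ^ k * d) := by ring

theorem choose_sub_sub_mul_pow_le {n d k : ℕ} (hkd : k ≤ d) (hdn : d ≤ n) :
    (n - k).choose (d - k) * n ^ k ≤ n.choose d * d ^ k := by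
  refine Nat.le_of_mul_le_mul_left ?_ (Nat.descFactorial_pos.2 (hkd.trans hdn))
  have hchoose : n.descFactorial k * (n - k).choose (d - k) = n.choose d * d.descFactorial k := by
    rw [Nat.descFactorial_eq_factorial_mul_choose, Nat.descFactorial_eq_factorial_mul_choose,
      mul_assoc, ← Nat.choose_mul hkd, mul_left_comm]
  calc n.descFactorial k * ((n - k).choose (d - k) * n ^ k)
      = n.choose d * (d.descFactorial k * n ^ k) := by rw [← mul_assoc, hchoose, mul_assoc]
    _ ≤ n.choose d * (n.descFactorial k * d ^ k) :=
        Nat.mul_le_mul_left _ (descFactorial_mul_pow_le hdn k)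
    _ = n.descFactorial k * (n.choose d * d ^ k) := mul_left_comm _ _ _

theorem card_filter_superset_le {n d : ℕ} (T : Finset (Fin n)) :
    ((Finset.univ.filter fun u : TensorIndex n d => T ⊆ u.1).card : ℝ) ≤
      n.choose d * ((d : ℝ) / n) ^ T.card := by
  rcases (Finset.univ.filter fun u : TensorIndex n d => T ⊆ u.1).eq_empty_or_nonempty with h | h
  · rw [h, Finset.card_empty, Nat.cast_zero]
    positivity
  obtain ⟨u, hu⟩ := h
  have hTd : T.card ≤ d := (Finset.card_le_card (Finset.mem_filter.1 hu).2).trans_eq u.2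
  have hdn : d ≤ n := by simpa [u.2] using u.1.card_le_univ
  have hcard : (Finset.univ.filter fun u : TensorIndex n d => T ⊆ u.1).card ≤
      (n - T.card).choose (d - T.card) := by
    have hfilter := Finset.card_filter_powersetCard_subset _ _ _ (Finset.subset_univ T) hTd
    rw [Finset.card_univ, Fintype.card_fin] at hfilter
    rw [← hfilter]
    refine Finset.card_le_card_of_injOn Subtype.val (fun u hu => ?_) Subtype.val_injective.injOn
    simpa [u.2] using hu
  have hn : (0 : ℝ) < (n : ℝ) ^ T.card := by
    rcases n.eq_zero_or_pos with rfl | hn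
    · simp [Nat.le_zero.1 (hTd.trans hdn)]
    · positivity
  rw [div_pow, ← mul_div_assoc, le_div_iff₀ hn]
  exact_mod_cast (Nat.mul_le_mul_right _ hcard).trans (choose_sub_sub_mul_pow_le hTd hdn)

theorem one_add_pow_card_inter {α : Type*} [DecidableEq α] (a : ℝ) (u W : Finset α) :
    (1 + a) ^ (u ∩ W).card = ∑ T ∈ W.powerset, if T ⊆ u then a ^ T.card else 0 := by
  have hbinom := Finset.sum_pow_mul_eq_add_pow a 1 (u ∩ W)
  simp only [one_pow, mul_one] at hbinom
  rw [add_comm, ← hbinom, ← Finset.sum_filter]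
  refine Finset.sum_congr (Finset.ext fun T => ?_) fun _ _ => rfl
  rw [Finset.mem_powerset, Finset.mem_filter, Finset.mem_powerset, Finset.subset_inter_iff,
    and_comm]

theorem sum_one_add_pow_card_inter_le {n d : ℕ} {a : ℝ} (ha : 0 ≤ a) (W : Finset (Fin n)) :
    ∑ u : TensorIndex n d, (1 + a) ^ (u.1 ∩ W).card ≤
      n.choose d * Real.exp (a * d * W.card / n) := by
  have hbinom := Finset.sum_pow_mul_eq_add_pow (a * (d / n : ℝ)) 1 W
  simp only [one_pow, mul_one] at hbinom
  calc ∑ u : TensorIndex n d, (1 + a) ^ (u.1 ∩ W).card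
      = ∑ T ∈ W.powerset,
          a ^ T.card * (Finset.univ.filter fun u : TensorIndex n d => T ⊆ u.1).card := by
        simp only [one_add_pow_card_inter]
        rw [Finset.sum_comm]
        refine Finset.sum_congr rfl fun T _ => ?_
        rw [← Finset.sum_filter, Finset.sum_const, nsmul_eq_mul, mul_comm]
    _ ≤ ∑ T ∈ W.powerset, a ^ T.card * (n.choose d * ((d : ℝ) / n) ^ T.card) := by
        gcongr
        exact card_filter_superset_le _
    _ = n.choose d * (a * (d / n) + 1) ^ W.card := by
        rw [← hbinom, Finset.mul_sum]
        exact Finset.sum_congr rfl fun T _ => by rw [mul_pow, mul_left_comm]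
    _ ≤ n.choose d * Real.exp (a * (d / n)) ^ W.card := by
        gcongr
        exact Real.add_one_le_exp _
    _ = n.choose d * Real.exp (a * d * W.card / n) := by
        rw [← Real.exp_nat_mul]
        ring_nf

end TensorIndex

section MixedMoments

/-- A centred probability law on `ℝ` with unit variance, vanishing third moment and finite fourth
moment. Quadratic forms of the tensors only involve these moments of their entries. -/
structure IsEntryLaw (μ : Measure ℝ) : Prop where
  integral_id : ∫ t, t ∂μ = 0
  integral_sq : ∫ t, t ^ 2 ∂μ = 1
  integral_cube : ∫ t, t ^ 3 ∂μ = 0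
  integrable_pow_four : Integrable (fun t : ℝ => t ^ 4) μ

variable {μ : Measure ℝ} [IsProbabilityMeasure μ]

theorem IsEntryLaw.integrable_pow (h : IsEntryLaw μ) {k : ℕ} (hk : k ≤ 4) :
    Integrable (fun t : ℝ => t ^ k) μ := by
  refine ((integrable_const (1 : ℝ)).add h.integrable_pow_four).mono' (by fun_prop)
    (ae_of_all _ fun t => ?_)
  rw [Pi.add_apply, norm_pow, Real.norm_eq_abs, ← (show Even 4 by decide).pow_abs t]
  rcases le_total |t| 1 with ht | ht
  · linarith [pow_le_one₀ (n := k) (abs_nonneg t) ht, pow_nonneg (abs_nonneg t) 4]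
  · linarith [pow_le_pow_right₀ ht hk]

theorem IsEntryLaw.integral_pow (h : IsEntryLaw μ) {k : ℕ} (hk : k ≤ 4) :
    ∫ t, t ^ k ∂μ = if Even k then if k = 4 then ∫ t, t ^ 4 ∂μ else 1 else 0 := by
  interval_cases k
  · simp
  · simpa using h.integral_id
  · simpa using h.integral_sq
  · simpa [show ¬ Even 3 by decide] using h.integral_cube
  · simp [show Even 4 by decide]

theorem IsEntryLaw.one_le_integral_pow_four (h : IsEntryLaw μ) : 1 ≤ ∫ t, t ^ 4 ∂μ := by
  have hsq : Integrable (fun t : ℝ => 2 * t ^ 2) μ := (h.integrable_pow (by norm_num)).const_mul 2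
  have hnonneg : 0 ≤ ∫ t, (t ^ 4 - 2 * t ^ 2 + 1) ∂μ :=
    integral_nonneg fun t => (sq_nonneg (t ^ 2 - 1)).trans_eq (by ring)
  rw [integral_add (h.integrable_pow_four.sub' hsq) (integrable_const 1),
    integral_sub h.integrable_pow_four hsq, integral_const_mul, h.integral_sq] at hnonneg
  simp only [integral_const, probReal_univ, smul_eq_mul] at hnonneg
  linarith

variable {α : Type*} [DecidableEq α]

/-- The number of the sets `s`, `t`, `u`, `v` that contain `i`. -/
def multiplicity (s t u v : Finset α) (i : α) : ℕ :=
  (if i ∈ s then 1 else 0) + (if i ∈ t then 1 else 0) + (if i ∈ u then 1 else 0) +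
    (if i ∈ v then 1 else 0)

theorem multiplicity_le (s t u v : Finset α) (i : α) : multiplicity s t u v i ≤ 4 := by
  unfold multiplicity
  split_ifs <;> omega

theorem even_multiplicity_iff (s t u v : Finset α) (i : α) :
    Even (multiplicity s t u v i) ↔ (i ∈ v ↔ (i ∈ u ↔ (i ∈ s ↔ i ∈ t))) := by
  by_cases hs : i ∈ s <;> by_cases ht : i ∈ t <;> by_cases hu : i ∈ u <;> by_cases hv : i ∈ v <;>
    simp [multiplicity, hs, ht, hu, hv, Nat.even_iff]

theorem mem_inter_of_multiplicity_eq_four {s t u v : Finset α} {i : α}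
    (h : multiplicity s t u v i = 4) : i ∈ u ∩ (s ∩ t) := by
  by_contra hi
  simp only [Finset.mem_inter, not_and_or] at hi
  unfold multiplicity at h
  split_ifs at h <;> simp_all

variable [Fintype α]

/-- The expectation of the product of the four monomials `∏_{i ∈ s} xᵢ`, …, `∏_{i ∈ v} xᵢ` in
independent variables `xᵢ` with law `μ`. -/
def mixedMoment (μ : Measure ℝ) (s t u v : Finset α) : ℝ :=
  ∫ x : α → ℝ, (∏ i ∈ s, x i) * (∏ i ∈ t, x i) * (∏ i ∈ u, x i) * (∏ i ∈ v, x i)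
    ∂Measure.pi fun _ => μ

theorem prod_mul_prod_eq_prod_pow_multiplicity (s t u v : Finset α) (x : α → ℝ) :
    (∏ i ∈ s, x i) * (∏ i ∈ t, x i) * (∏ i ∈ u, x i) * (∏ i ∈ v, x i) =
      ∏ i, x i ^ multiplicity s t u v i := by
  have hprod (s : Finset α) : ∏ i ∈ s, x i = ∏ i, x i ^ (if i ∈ s then 1 else 0) := by
    simp [pow_ite, Finset.prod_ite_mem]
  simp only [multiplicity, pow_add, Finset.prod_mul_distrib, ← hprod]

theorem mixedMoment_eq_prod (s t u v : Finset α) :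
    mixedMoment μ s t u v = ∏ i, ∫ y, y ^ multiplicity s t u v i ∂μ := by
  simp only [mixedMoment, prod_mul_prod_eq_prod_pow_multiplicity]
  exact integral_fintype_prod_eq_prod fun i (y : ℝ) => y ^ multiplicity s t u v i

omit [DecidableEq α] in
theorem IsEntryLaw.integrable_prod (h : IsEntryLaw μ) (s t u v : Finset α) :
    Integrable (fun x : α → ℝ =>
      (∏ i ∈ s, x i) * (∏ i ∈ t, x i) * (∏ i ∈ u, x i) * (∏ i ∈ v, x i))
      (Measure.pi fun _ => μ) := by
  classical
  simp only [prod_mul_prod_eq_prod_pow_multiplicity]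
  exact Integrable.fintype_prod (f := fun i (y : ℝ) => y ^ multiplicity s t u v i)
    fun i => h.integrable_pow (multiplicity_le s t u v i)

omit [DecidableEq α] in
theorem IsEntryLaw.mixedMoment_nonneg (h : IsEntryLaw μ) (s t u v : Finset α) :
    0 ≤ mixedMoment μ s t u v := by
  classical
  have hfourth := h.one_le_integral_pow_four
  rw [mixedMoment_eq_prod]
  refine Finset.prod_nonneg fun i _ => ?_
  rw [h.integral_pow (multiplicity_le s t u v i)]
  split_ifs <;> linarith

theorem IsEntryLaw.mixedMoment_le (h : IsEntryLaw μ) (s t u v : Finset α) :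
    mixedMoment μ s t u v ≤ (∫ t, t ^ 4 ∂μ) ^ (u ∩ (s ∩ t)).card := by
  have hfourth := h.one_le_integral_pow_four
  have hpow : (∫ t, t ^ 4 ∂μ) ^ (u ∩ (s ∩ t)).card =
      ∏ i, if i ∈ u ∩ (s ∩ t) then ∫ t, t ^ 4 ∂μ else 1 := by
    rw [Finset.prod_ite_mem, Finset.univ_inter, Finset.prod_const]
  rw [mixedMoment_eq_prod, hpow]
  refine Finset.prod_le_prod (fun i _ => ?_) fun i _ => ?_
  · rw [h.integral_pow (multiplicity_le s t u v i)]
    split_ifs <;> linarith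
  · rw [h.integral_pow (multiplicity_le s t u v i)]
    by_cases hfour : multiplicity s t u v i = 4
    · rw [if_pos hfour, if_pos (mem_inter_of_multiplicity_eq_four hfour)]
      split_ifs <;> linarith
    · rw [if_neg hfour]
      split_ifs <;> linarith

omit [DecidableEq α] in
theorem IsEntryLaw.mem_iff_of_mixedMoment_ne_zero (h : IsEntryLaw μ) {s t u v : Finset α}
    (hne : mixedMoment μ s t u v ≠ 0) (i : α) : i ∈ v ↔ (i ∈ u ↔ (i ∈ s ↔ i ∈ t)) := by
  classical
  rw [mixedMoment_eq_prod, Finset.prod_ne_zero_iff] at hne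
  have hi := hne i (Finset.mem_univ i)
  rw [h.integral_pow (multiplicity_le s t u v i)] at hi
  exact (even_multiplicity_iff s t u v i).1 (by_contra fun hodd => hi (if_neg hodd))

omit [DecidableEq α] in
theorem IsEntryLaw.mixedMoment_eq_zero_of_ne (h : IsEntryLaw μ) {u v : Finset α} (huv : u ≠ v)
    (s : Finset α) : mixedMoment μ s s u v = 0 := by
  by_contra hne
  refine huv (Finset.ext fun i => ?_)
  simpa using (h.mem_iff_of_mixedMoment_ne_zero hne i).symm

omit [DecidableEq α] in
theorem IsEntryLaw.one_le_mixedMoment_pair (h : IsEntryLaw μ) (s u : Finset α) :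
    1 ≤ mixedMoment μ s s u u := by
  classical
  have hfourth := h.one_le_integral_pow_four
  rw [mixedMoment_eq_prod]
  refine Finset.prod_const_one.symm.trans_le
    (Finset.prod_le_prod (s := Finset.univ) (fun _ _ => zero_le_one) fun i _ => ?_)
  rw [h.integral_pow (multiplicity_le s s u u i),
    if_pos ((even_multiplicity_iff s s u u i).2 (by tauto))]
  split_ifs <;> linarith

omit [IsProbabilityMeasure μ] [DecidableEq α] in
theorem mixedMoment_swap (s t u v : Finset α) :
    mixedMoment μ s t u v = mixedMoment μ u v s t := by
  unfold mixedMoment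
  congr 1 with x
  ring

theorem IsEntryLaw.mixedMoment_empty (h : IsEntryLaw μ) (s t : Finset α) :
    mixedMoment μ s t ∅ ∅ = if s = t then 1 else 0 := by
  split_ifs with hst
  · subst hst
    refine le_antisymm ((h.mixedMoment_le s s ∅ ∅).trans_eq ?_) (h.one_le_mixedMoment_pair s ∅)
    rw [Finset.empty_inter, Finset.card_empty, pow_zero]
  · rw [mixedMoment_swap, h.mixedMoment_eq_zero_of_ne hst]

end MixedMoments

section QuadraticForms

open Matrix

/-- Schur's test for a symmetric kernel with nonnegative entries. -/
theorem sum_mul_mul_le_of_symm {α : Type*} [Fintype α] {κ : α → α → ℝ} (hκ : ∀ a b, 0 ≤ κ a b)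
    (hsymm : ∀ a b, κ a b = κ b a) (f : α → ℝ) :
    ∑ a, ∑ b, f a * (f b * κ a b) ≤ ∑ a, f a ^ 2 * ∑ b, κ a b := by
  have hswap : ∑ a, ∑ b, f b ^ 2 * κ a b = ∑ a, ∑ b, f a ^ 2 * κ a b := by
    rw [Finset.sum_comm]
    simp only [hsymm]
  have hamgm : ∑ a, ∑ b, 2 * (f a * (f b * κ a b)) ≤
      ∑ a, ∑ b, (f a ^ 2 * κ a b + f b ^ 2 * κ a b) :=
    Finset.sum_le_sum fun a _ => Finset.sum_le_sum fun b _ => by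
      nlinarith [mul_nonneg (hκ a b) (sq_nonneg (f a - f b))]
  simp only [Finset.sum_add_distrib, ← Finset.mul_sum, hswap] at hamgm ⊢
  linarith

theorem dotProduct_mulVec_eq_sum {ι : Type*} [Fintype ι] (A : Matrix ι ι ℝ) (z : ι → ℝ) :
    z ⬝ᵥ A *ᵥ z = ∑ a : ι × ι, A a.1 a.2 * (z a.1 * z a.2) := by
  rw [Fintype.sum_prod_type]
  simp only [dotProduct, mulVec, Finset.mul_sum, mul_left_comm]

theorem variance_sum_mul_le {Ω α : Type*} [MeasurableSpace Ω] {P : Measure Ω}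
    [IsFiniteMeasure P] [Fintype α] {X : α → Ω → ℝ} {c : ℝ} (hX : ∀ a, MemLp (X a) 2 P)
    (hcov : ∀ a b, 0 ≤ cov[X a, X b; P]) (hsum : ∀ a, ∑ b, cov[X a, X b; P] ≤ c) (f : α → ℝ) :
    Var[fun ω => ∑ a, f a * X a ω; P] ≤ (∑ a, f a ^ 2) * c := by
  have hfX (a : α) : MemLp (fun ω => f a * X a ω) 2 P := (hX a).const_mul _
  calc Var[fun ω => ∑ a, f a * X a ω; P]
      = ∑ a, ∑ b, f a * (f b * cov[X a, X b; P]) := by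
        rw [← covariance_self (memLp_finsetSum _ fun a _ => hfX a).aemeasurable,
          covariance_fun_sum_fun_sum hfX hfX]
        simp only [covariance_const_mul_left, covariance_const_mul_right, mul_left_comm]
    _ ≤ ∑ a, f a ^ 2 * ∑ b, cov[X a, X b; P] :=
        sum_mul_mul_le_of_symm hcov (fun _ _ => covariance_comm _ _) f
    _ ≤ (∑ a, f a ^ 2) * c := by
        rw [Finset.sum_mul]
        gcongr with a
        exact hsum a

theorem quadFormVarianceLE_of_covariance {ι : Type*} [Fintype ι] [DecidableEq ι]
    {ν : Measure (ι → ℝ)} [IsFiniteMeasure ν] {δ : ℝ}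
    (hL2 : ∀ s t, MemLp (fun z : ι → ℝ => z s * z t) 2 ν)
    (hiso : ∀ s t, ∫ z, z s * z t ∂ν = (1 : Matrix ι ι ℝ) s t)
    (hcov : ∀ s t u v, 0 ≤ cov[fun z => z s * z t, fun z => z u * z v; ν])
    (hsum : ∀ s t, ∑ u, ∑ v, cov[fun z => z s * z t, fun z => z u * z v; ν] ≤
      Fintype.card ι * δ) :
    QuadFormVarianceLE ν δ := by
  intro A hA
  have hAL2 (a : ι × ι) : MemLp (fun z : ι → ℝ => A a.1 a.2 * (z a.1 * z a.2)) 2 ν :=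
    (hL2 a.1 a.2).const_mul _
  have hform : MemLp (fun z : ι → ℝ => ∑ a : ι × ι, A a.1 a.2 * (z a.1 * z a.2)) 2 ν :=
    memLp_finsetSum _ fun a _ => hAL2 a
  have hmean : ∫ z, ∑ a : ι × ι, A a.1 a.2 * (z a.1 * z a.2) ∂ν = A.trace := by
    rw [integral_finsetSum _ fun a _ => (hAL2 a).integrable one_le_two, Fintype.sum_prod_type]
    simp only [integral_const_mul, hiso, one_apply, mul_ite, mul_one, mul_zero,
      Finset.sum_ite_eq, Finset.mem_univ, if_true, trace, diag_apply]
  have hrows : ∑ a : ι × ι, A a.1 a.2 ^ 2 ≤ Fintype.card ι := by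
    rw [Fintype.sum_prod_type]
    refine (Finset.sum_le_sum fun s _ => hA s).trans_eq ?_
    rw [Finset.sum_const, Finset.card_univ, nsmul_eq_mul, mul_one]
  have hsum' (a : ι × ι) :
      ∑ b : ι × ι, cov[fun z => z a.1 * z a.2, fun z => z b.1 * z b.2; ν] ≤
        Fintype.card ι * δ := by
    rw [Fintype.sum_prod_type]
    exact hsum a.1 a.2
  simp only [dotProduct_mulVec_eq_sum]
  rw [← hmean, ← evariance_eq_lintegral_ofReal, ← ofReal_variance hform]
  refine ENNReal.ofReal_le_ofReal ?_
  have hvar := variance_sum_mul_le (fun a : ι × ι => hL2 a.1 a.2)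
    (fun a b => hcov a.1 a.2 b.1 b.2) hsum' fun a => A a.1 a.2
  refine hvar.trans ?_
  rcases isEmpty_or_nonempty (ι × ι) with _ | ⟨⟨a⟩⟩
  · simp [Fintype.card_eq_zero_iff.2 ((isEmpty_prod.1 ‹_›).elim id id)]
  · have hc : 0 ≤ Fintype.card ι * δ :=
      (Finset.sum_nonneg fun b _ => hcov a.1 a.2 b.1 b.2).trans (hsum' a)
    calc (∑ a : ι × ι, A a.1 a.2 ^ 2) * (Fintype.card ι * δ)
        ≤ Fintype.card ι * (Fintype.card ι * δ) := mul_le_mul_of_nonneg_right hrows hc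
      _ = Fintype.card ι ^ 2 * δ := by ring

end QuadraticForms

section TensorCovariance

variable {n d : ℕ} {μ : Measure ℝ}

theorem measurable_tensorVector : Measurable (tensorVector n d) := by
  unfold tensorVector
  fun_prop

variable [IsProbabilityMeasure μ]

instance isProbabilityMeasure_tensorLaw : IsProbabilityMeasure (tensorLaw n d μ) :=
  Measure.isProbabilityMeasure_map measurable_tensorVector.aemeasurable

omit [IsProbabilityMeasure μ] in
theorem integral_tensorLaw_four (s t u v : TensorIndex n d) :
    ∫ z, z s * z t * (z u * z v) ∂tensorLaw n d μ = mixedMoment μ s.1 t.1 u.1 v.1 := by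
  rw [tensorLaw, integral_map measurable_tensorVector.aemeasurable (by fun_prop)]
  simp only [mixedMoment, tensorVector, mul_assoc]

theorem IsEntryLaw.integral_tensorLaw_two (h : IsEntryLaw μ) (s t : TensorIndex n d) :
    ∫ z, z s * z t ∂tensorLaw n d μ = (1 : Matrix _ _ ℝ) s t := by
  have hempty := h.mixedMoment_empty s.1 t.1
  simp only [mixedMoment, Finset.prod_empty, mul_one] at hempty
  rw [tensorLaw, integral_map measurable_tensorVector.aemeasurable (by fun_prop),
    Matrix.one_apply]
  simpa only [tensorVector, Subtype.ext_iff] using hempty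

theorem IsEntryLaw.memLp_mul (h : IsEntryLaw μ) (s t : TensorIndex n d) :
    MemLp (fun z : TensorIndex n d → ℝ => z s * z t) 2 (tensorLaw n d μ) := by
  rw [memLp_two_iff_integrable_sq (by fun_prop), tensorLaw,
    integrable_map_measure (by fun_prop) measurable_tensorVector.aemeasurable]
  simpa only [Function.comp_def, tensorVector, pow_two, mul_assoc] using
    h.integrable_prod s.1 t.1 s.1 t.1

theorem IsEntryLaw.covariance_tensorLaw (h : IsEntryLaw μ) (s t u v : TensorIndex n d) :
    cov[fun z => z s * z t, fun z => z u * z v; tensorLaw n d μ] =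
      mixedMoment μ s.1 t.1 u.1 v.1 - (1 : Matrix _ _ ℝ) s t * (1 : Matrix _ _ ℝ) u v := by
  rw [covariance_eq_sub (h.memLp_mul s t) (h.memLp_mul u v), h.integral_tensorLaw_two,
    h.integral_tensorLaw_two, ← integral_tensorLaw_four]
  rfl

theorem IsEntryLaw.covariance_tensorLaw_nonneg (h : IsEntryLaw μ) (s t u v : TensorIndex n d) :
    0 ≤ cov[fun z => z s * z t, fun z => z u * z v; tensorLaw n d μ] := by
  rw [h.covariance_tensorLaw, sub_nonneg, Matrix.one_apply, Matrix.one_apply]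
  split_ifs with hst huv
  · subst hst huv
    simpa only [mul_one] using h.one_le_mixedMoment_pair s.1 u.1
  all_goals simpa only [mul_zero, zero_mul] using h.mixedMoment_nonneg _ _ _ _

/-- For `s ≠ t`, the indices `s`, `t`, `u` determine the only `v` with a nonzero moment. It differs
from `u`, so `u` meets the symmetric difference of `s` and `t`. -/
theorem IsEntryLaw.sum_mixedMoment_le_of_ne (h : IsEntryLaw μ) {s t : TensorIndex n d}
    (hst : s ≠ t) (u : TensorIndex n d) :
    ∑ v : TensorIndex n d, mixedMoment μ s.1 t.1 u.1 v.1 ≤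
      (1 + ∫ x, x ^ 4 ∂μ) ^ (u.1 ∩ (s.1 ∪ t.1)).card - 1 := by
  have hfourth := h.one_le_integral_pow_four
  by_cases hzero : ∀ v : TensorIndex n d, mixedMoment μ s.1 t.1 u.1 v.1 = 0
  · simp only [hzero, Finset.sum_const_zero, sub_nonneg]
    exact one_le_pow₀ (by linarith)
  push Not at hzero
  obtain ⟨v, hv⟩ := hzero
  have hmem := h.mem_iff_of_mixedMoment_ne_zero hv
  have hunique (w : TensorIndex n d) (hw : w ≠ v) : mixedMoment μ s.1 t.1 u.1 w.1 = 0 := by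
    by_contra hne
    exact hw (Subtype.ext (Finset.ext fun i => by
      rw [hmem i, h.mem_iff_of_mixedMoment_ne_zero hne i]))
  have huv : u ≠ v := by
    rintro rfl
    exact hst (Subtype.ext (Finset.ext fun i => by have := hmem i; tauto))
  obtain ⟨i, hiu, hiv⟩ := Finset.not_subset.1 fun hsub =>
    huv (Subtype.ext (Finset.eq_of_subset_of_card_le hsub (by rw [u.2, v.2])))
  have hssub : u.1 ∩ (s.1 ∩ t.1) ⊂ u.1 ∩ (s.1 ∪ t.1) := by
    have hi := hmem i
    refine (Finset.ssubset_iff_of_subset fun j => ?_).2 ⟨i, ?_⟩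
    all_goals simp only [Finset.mem_inter, Finset.mem_union]; tauto
  set k := (u.1 ∩ (s.1 ∩ t.1)).card
  rw [Finset.sum_eq_single_of_mem v (Finset.mem_univ v) fun w _ => hunique w, le_sub_iff_add_le]
  calc mixedMoment μ s.1 t.1 u.1 v.1 + 1
      ≤ (∫ x, x ^ 4 ∂μ) ^ k + 1 := by gcongr; exact h.mixedMoment_le _ _ _ _
    _ ≤ (1 + ∫ x, x ^ 4 ∂μ) ^ k * (1 + ∫ x, x ^ 4 ∂μ) := by
        nlinarith [pow_le_pow_left₀ (by linarith : 0 ≤ ∫ x, x ^ 4 ∂μ)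
          (by linarith : ∫ x, x ^ 4 ∂μ ≤ 1 + ∫ x, x ^ 4 ∂μ) k,
          one_le_pow₀ (n := k) (by linarith : 1 ≤ 1 + ∫ x, x ^ 4 ∂μ)]
    _ ≤ (1 + ∫ x, x ^ 4 ∂μ) ^ (u.1 ∩ (s.1 ∪ t.1)).card := by
        rw [← pow_succ]
        exact pow_le_pow_right₀ (by linarith) (Finset.card_lt_card hssub)

theorem IsEntryLaw.sum_covariance_tensorLaw_le (h : IsEntryLaw μ) (s t u : TensorIndex n d) :
    ∑ v, cov[fun z => z s * z t, fun z => z u * z v; tensorLaw n d μ] ≤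
      (1 + ∫ x, x ^ 4 ∂μ) ^ (u.1 ∩ (s.1 ∪ t.1)).card - 1 := by
  have hfourth := h.one_le_integral_pow_four
  simp only [h.covariance_tensorLaw]
  by_cases hst : s = t
  · subst hst
    rw [Finset.sum_eq_single_of_mem u (Finset.mem_univ u) fun v _ hv => by
      rw [h.mixedMoment_eq_zero_of_ne (Subtype.coe_ne_coe.2 hv.symm), Matrix.one_apply_ne hv.symm,
        mul_zero, sub_zero]]
    rw [Matrix.one_apply_eq, Matrix.one_apply_eq, mul_one, Finset.union_self]
    have hpair := h.mixedMoment_le s.1 s.1 u.1 u.1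
    rw [Finset.inter_self] at hpair
    gcongr
    exact hpair.trans (pow_le_pow_left₀ (by linarith) (by linarith) _)
  · simpa only [Matrix.one_apply_ne hst, zero_mul, sub_zero] using h.sum_mixedMoment_le_of_ne hst u

theorem IsEntryLaw.quadFormVarianceLE_tensorLaw (h : IsEntryLaw μ) (n d : ℕ) :
    QuadFormVarianceLE (tensorLaw n d μ) (Real.exp (2 * (∫ x, x ^ 4 ∂μ) * d ^ 2 / n) - 1) := by
  have hfourth := h.one_le_integral_pow_four
  refine quadFormVarianceLE_of_covariance h.memLp_mul h.integral_tensorLaw_two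
    h.covariance_tensorLaw_nonneg fun s t => ?_
  have hcard : ((s.1 ∪ t.1).card : ℝ) ≤ 2 * d := by
    have hunion := Finset.card_union_le s.1 t.1
    rw [s.2, t.2, ← two_mul] at hunion
    exact_mod_cast hunion
  calc ∑ u, ∑ v, cov[fun z => z s * z t, fun z => z u * z v; tensorLaw n d μ]
      ≤ ∑ u : TensorIndex n d, ((1 + ∫ x, x ^ 4 ∂μ) ^ (u.1 ∩ (s.1 ∪ t.1)).card - 1) :=
        Finset.sum_le_sum fun u _ => h.sum_covariance_tensorLaw_le s t u
    _ ≤ n.choose d * Real.exp ((∫ x, x ^ 4 ∂μ) * d * (s.1 ∪ t.1).card / n) - n.choose d := by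
        rw [Finset.sum_sub_distrib, Finset.sum_const, Finset.card_univ, card_tensorIndex,
          nsmul_eq_mul, mul_one]
        gcongr
        exact sum_one_add_pow_card_inter_le (by linarith) _
    _ ≤ n.choose d * Real.exp ((∫ x, x ^ 4 ∂μ) * d * (2 * d) / n) - n.choose d := by gcongr
    _ = Fintype.card (TensorIndex n d) *
          (Real.exp (2 * (∫ x, x ^ 4 ∂μ) * d ^ 2 / n) - 1) := by
        rw [card_tensorIndex]
        ring_nf

end TensorCovariance

section Asymptotics

theorem le_choose_of_lt {n d : ℕ} (hd : 1 ≤ d) (hdn : d < n) : n ≤ n.choose d := by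
  induction n generalizing d with
  | zero => omega
  | succ n ih =>
    obtain ⟨e, rfl⟩ := Nat.exists_eq_add_of_le' hd
    have hpos : 0 < n.choose e := Nat.choose_pos (by omega)
    rw [Nat.choose_succ_succ']
    rcases (Nat.lt_succ_iff.1 hdn).eq_or_lt with rfl | hlt
    · simp
    · have := ih hd hlt
      omega

theorem eventually_le_choose {d : ℕ → ℕ} {m : ℕ → ℝ} (hd : ∀ᶠ n : ℕ in atTop, 1 ≤ d n)
    (hm : ∀ n, 1 ≤ m n) (h : Tendsto (fun n : ℕ => m n * d n ^ 2 / n) atTop (𝓝 0)) :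
    ∀ᶠ n : ℕ in atTop, n ≤ n.choose (d n) := by
  filter_upwards [hd, h.eventually_lt_const (zero_lt_one' ℝ), eventually_gt_atTop 0]
    with n hdn hlt hn
  refine le_choose_of_lt hdn (Nat.cast_lt (α := ℝ).1 ?_)
  have hd_one : (1 : ℝ) ≤ d n := Nat.one_le_cast.2 hdn
  calc (d n : ℝ) ≤ d n ^ 2 := le_self_pow₀ hd_one two_ne_zero
    _ ≤ m n * d n ^ 2 := le_mul_of_one_le_left (sq_nonneg _) (hm n)
    _ < n := (div_lt_one (Nat.cast_pos.2 hn)).1 hlt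

theorem tendsto_div_of_tendsto_log_div_log {κ : Type*} {l : Filter κ} {C r : κ → ℝ}
    (hC : ∀ k, 2 ≤ C k) (hr : ∀ᶠ k in l, 1 < r k)
    (h : Tendsto (fun k => Real.log (C k) / Real.log (r k)) l (𝓝 0)) :
    Tendsto (fun k => C k / r k) l (𝓝 0) := by
  have hC_pos (k : κ) : 0 < C k := two_pos.trans_le (hC k)
  refine tendsto_order.2 ⟨fun a ha => ?_, fun ε hε => ?_⟩
  · filter_upwards [hr] with k hk
    exact ha.trans (div_pos (hC_pos k) (one_pos.trans hk))
  · obtain ⟨j, hj⟩ := exists_pow_lt_of_lt_one hε (one_half_lt_one (α := ℝ))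
    filter_upwards [hr, h.eventually_le_const (u := 1 / ((j : ℝ) + 1)) (by positivity)]
      with k hk hlog
    have hr_pos : 0 < r k := one_pos.trans hk
    have hpow : C k ^ (j + 1) ≤ r k := by
      rw [div_le_div_iff₀ (Real.log_pos hk) (by positivity), one_mul, mul_comm] at hlog
      rw [← Real.log_le_log_iff (pow_pos (hC_pos k) _) hr_pos, Real.log_pow]
      exact_mod_cast hlog
    calc C k / r k ≤ C k / C k ^ (j + 1) := by have := hC_pos k; gcongr
      _ = (1 / C k) ^ j := by
        rw [pow_succ', ← div_div, div_self (hC_pos k).ne', one_div_pow]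
      _ ≤ (1 / 2) ^ j := by have := hC_pos k; gcongr; exact hC k
      _ < ε := hj

theorem tendsto_mul_sq_div_of_log {d : ℕ → ℕ} {C m : ℕ → ℝ} (hC : ∀ n, 2 ≤ C n)
    (hd : ∀ᶠ n : ℕ in atTop, 1 ≤ d n ∧ (d n : ℝ) < √(n : ℝ))
    (hClim : Tendsto (fun n : ℕ => Real.log (C n) / Real.log (√(n : ℝ) / d n)) atTop (𝓝 0))
    (hm : ∀ n, 0 ≤ m n) (hmC : ∀ n, m n ≤ (2 * C n) ^ 2) :
    Tendsto (fun n : ℕ => m n * d n ^ 2 / n) atTop (𝓝 0) := by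
  have hr : ∀ᶠ n : ℕ in atTop, 1 < √(n : ℝ) / d n := by
    filter_upwards [hd] with n hn
    exact (one_lt_div (Nat.cast_pos.2 hn.1)).2 hn.2
  have hlim := ((tendsto_div_of_tendsto_log_div_log hC hr hClim).const_mul 2).pow 2
  rw [mul_zero, zero_pow two_ne_zero] at hlim
  refine squeeze_zero (fun n => ?_) (fun n => ?_) hlim
  · have := hm n
    positivity
  · calc m n * d n ^ 2 / n ≤ (2 * C n) ^ 2 * d n ^ 2 / n := by gcongr; exact hmC n
      _ = (2 * (C n / (√(n : ℝ) / d n))) ^ 2 := by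
        rw [div_div_eq_mul_div, mul_div_assoc', div_pow, Real.sq_sqrt (Nat.cast_nonneg n)]
        ring

end Asymptotics

section SymmetricLaws

variable {μ : Measure ℝ}

theorem integral_pow_eq_zero_of_odd (hsymm : μ.map (fun t => -t) = μ) {k : ℕ} (hk : Odd k) :
    ∫ t, t ^ k ∂μ = 0 := by
  have hneg : ∫ t, t ^ k ∂μ = ∫ t, (-t) ^ k ∂μ := by
    conv_lhs => rw [← hsymm]
    rw [integral_map (by fun_prop) (by fun_prop)]
  simp only [hk.neg_pow, integral_neg] at hneg
  linarith

theorem isEntryLaw_of_map_neg_eq (hsymm : μ.map (fun t => -t) = μ) (hvar : ∫ t, t ^ 2 ∂μ = 1)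
    (hfourth : Integrable (fun t : ℝ => t ^ 4) μ) : IsEntryLaw μ where
  integral_id := by simpa only [pow_one] using integral_pow_eq_zero_of_odd hsymm odd_one
  integral_sq := hvar
  integral_cube := integral_pow_eq_zero_of_odd hsymm (by decide)
  integrable_pow_four := hfourth

end SymmetricLaws

end RandomTensor

end

open RandomTensor in
theorem mainTheorem1_general {Ω : Type*} [MeasurableSpace Ω] {P : Measure Ω} {d p : ℕ → ℕ}
    {γ : ℝ} {μ : ℕ → Measure ℝ} [∀ n, IsProbabilityMeasure (μ n)]
    {Z : ∀ n, Ω → Matrix (TensorIndex n (d n)) (Fin (p n)) ℝ}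
    (hd : ∀ᶠ n in atTop, 1 ≤ d n) (hentry : ∀ n, IsEntryLaw (μ n))
    (hfourth : Tendsto (fun n : ℕ => (∫ t, t ^ 4 ∂μ n) * d n ^ 2 / n) atTop (𝓝 0))
    (hγ : 0 < γ) (hratio : Tendsto (fun n : ℕ => (n.choose (d n) : ℝ) / p n) atTop (𝓝 γ))
    (hindep : ∀ n, iIndepFun (fun (j : Fin (p n)) (ω : Ω) => fun s => Z n ω s j) P)
    (hlaw : ∀ n (j : Fin (p n)),
      HasLaw (fun ω s => Z n ω s j) (tensorLaw n (d n) (μ n)) P) :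
    ∀ᵐ ω ∂P, WeaklyConverges (fun n => esd (sampleCov_isHermitian (Z n ω))) (mpCDF γ) := by
  have hδ : Tendsto (fun n : ℕ => Real.exp (2 * (∫ t, t ^ 4 ∂μ n) * d n ^ 2 / n) - 1)
      atTop (𝓝 0) := by
    simpa [mul_assoc, mul_div_assoc] using ((hfourth.const_mul 2).rexp).sub_const 1
  refine ae_weaklyConverges_esd_mpCDF hγ ?_ ?_ (fun n => (hindep n).hasLaw_pi (hlaw n))
    (fun n _ => (hentry n).quadFormVarianceLE_tensorLaw n (d n)) hδ
  · simpa only [card_tensorIndex] using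
      eventually_le_choose hd (fun n => (hentry n).one_le_integral_pow_four) hfourth
  · simpa only [card_tensorIndex] using hratio

theorem mainTheorem1 {Ω : Type*} [MeasurableSpace Ω] (P : Measure Ω) [IsProbabilityMeasure P]
    (d p : ℕ → ℕ) (C : ℕ → ℝ) (γ : ℝ)
    -- `μ n` is the law of `x₁ = x(n)`
    (μ : ℕ → Measure ℝ) [∀ n, IsProbabilityMeasure (μ n)]
    (Z : (n : ℕ) → Ω → Matrix (RandomTensor.TensorIndex n (d n)) (Fin (p n)) ℝ)
    -- `1 ≤ d < n^{1/2}`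
    (hd : ∀ᶠ n : ℕ in atTop, 1 ≤ d n ∧ (d n : ℝ) < √(n : ℝ))
    -- the entries are symmetric with unit variance and controlled even moments
    (hsymm : ∀ n, (μ n).map (fun t => -t) = μ n)
    (hvar : ∀ n, ∫ t, t ^ 2 ∂(μ n) = 1)
    (hC : ∀ n, 2 ≤ C n)
    (hmom : ∀ n k : ℕ, Integrable (fun t : ℝ => t ^ (2 * k)) (μ n) ∧
      ∫ t, t ^ (2 * k) ∂(μ n) ≤ (C n * k) ^ k)
    (hClim : Tendsto (fun n : ℕ => Real.log (C n) / Real.log (√(n : ℝ) / d n)) atTop (𝓝 0))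
    -- `N / p → γ ∈ (0, ∞)`, with `N = n.choose d`
    (hγ : 0 < γ)
    (hratio : Tendsto (fun n : ℕ => (n.choose (d n) : ℝ) / p n) atTop (𝓝 γ))
    -- the columns of `Z n` are i.i.d. with the law of the random tensor product
    (hindep : ∀ n, iIndepFun (fun (j : Fin (p n)) (ω : Ω) => fun s => Z n ω s j) P)
    (hlaw : ∀ n (j : Fin (p n)),
      HasLaw (fun ω s => Z n ω s j) (RandomTensor.tensorLaw n (d n) (μ n)) P) :
    ∀ᵐ ω ∂P, RandomTensor.WeaklyConverges
      (fun n => RandomTensor.esd (RandomTensor.sampleCov_isHermitian (Z n ω)))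
      (RandomTensor.mpCDF γ) := by
  have hentry (n : ℕ) : RandomTensor.IsEntryLaw (μ n) :=
    RandomTensor.isEntryLaw_of_map_neg_eq (hsymm n) (hvar n) (hmom n 2).1
  have hfourth_le (n : ℕ) : ∫ t, t ^ 4 ∂μ n ≤ (2 * C n) ^ 2 :=
    (hmom n 2).2.trans_eq (by push_cast; ring)
  exact mainTheorem1_general (hd.mono fun _ hn => hn.1) hentry
    (RandomTensor.tendsto_mul_sq_div_of_log hC hd hClim
      (fun n => zero_le_one.trans (hentry n).one_le_integral_pow_four) hfourth_le)
    hγ hratio hindep hlaw
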